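/- Let $n\ge 1$, $\epsilon\in\{1,-1\}$ and $H>0$. Equip $\mathbb R^{n+1}$, with coordinates $y^0,\dots,y^n$ and its standard orientation, with the metric $\eta=\mathrm{diag}(+1,-1,\dots,-1,-\epsilon)$, so that $\eta^{nn}=-\epsilon$, and write $y^2=\eta(y,y)$. Let $\Sigma=\{y\in\mathbb R^{n+1} : y^2=-\epsilon H^{-2}\}$ be the de Sitter ($\epsilon=1$) or anti-de Sitter ($\epsilon=-1$) space, with the induced pseudo-Riemannian metric, let $m:\Sigma\to\mathbb R^{n+1}$ be the inclusion, and let $e_n=|y^2|^{-1/2}\,y^A\partial_A$ (defined where $y^2\ne0$), whose restriction to $\Sigma$ is the exterior unit normal; $\Sigma$ is oriented so that a frame $(v_0,\dots,v_{n-1})$ is direct when $(v_0,\dots,v_{n-1},e_n)$ is. On an oriented pseudo-Riemannian manifold with Hodge operator $*$, put $\delta\alpha=(-1)^a*^{-1}d*\alpha$ for an $a$-form $\alpha$ (so $\delta=0$ on functions) and $\square=-(d\delta+\delta d)$; write $\delta_{n+1},\square_{n+1}$ for these operators on $(\mathbb R^{n+1},\eta)$ and $\delta_\Sigma,\square_\Sigma$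 for those on $\Sigma$. Let $i_n$ be the interior product with $e_n$ (zero on functions) and $\mathscr L_n=i_nd+d\,i_n$ the Lie derivative along $e_n$. Let $a\ge0$, let $\alpha$ be a smooth $a$-form on $\mathbb R^{n+1}$, or only on an open neighbourhood of $\Sigma$, and put $\alpha_\Sigma=m^*\alpha$. Then $$m^*\delta_{n+1}\alpha=\delta_\Sigma\alpha_\Sigma-\eta^{nn}\,m^*\big[\mathscr L_n i_n\alpha+H(n-2a+2)\,i_n\alpha\big],$$ $$m^*\square_{n+1}\alpha=\square_\Sigma\alpha_\Sigma+\eta^{nn}\,m^*\big[\mathscr L_n^2\alpha+H(n-2a)\,\mathscr L_n\alpha+2H\,d\,i_n\alpha\big].$$ -/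

import Mathlib

open scoped ContDiff

noncomputable section

namespace AdS

/-! ### Linear algebra: contraction, raising of indices, Hodge operator -/

section LinearAlgebra

variable {T : Type*} [NormedAddCommGroup T] [NormedSpace ℝ T]

/-- The iterated interior product `i_{u_{p-1}} ⋯ i_{u_1} i_{u_0} w`, that is
`(v_0, …) ↦ w (u_0, …, u_{p-1}, v_0, …)`. -/
def contract {q : ℕ} : (p : ℕ) → (Fin p → T) → T [⋀^Fin (q + p)]→L[ℝ] ℝ → T [⋀^Fin q]→L[ℝ] ℝ
  | 0, _, w => w
  | p + 1, u, w => contract p (Fin.tail u) (w.curryLeft (u 0))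

/-- The vector `∑ j, g^{ij} b_j`, where `(g^{ij})` is the inverse of the Gram matrix of the
basis `b`: the `i`-th covector of the dual basis, with its index raised. -/
def raised {ι : Type*} [Fintype ι] [DecidableEq ι] (g : LinearMap.BilinForm ℝ T)
    (b : Module.Basis ι ℝ T) (i : ι) : T :=
  ∑ j, (Matrix.of fun k l => g (b k) (b l))⁻¹ i j • b j

/-- An alternating map in `N` arguments regarded as one in `M = N` arguments. -/
def reindex {M N : ℕ} (h : M = N) (w : T [⋀^Fin N]→L[ℝ] ℝ) : T [⋀^Fin M]→L[ℝ] ℝ :=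
  { w.toAlternatingMap.domDomCongr (finCongr h.symm) with
    cont := w.cont.comp (continuous_pi fun i => continuous_apply (finCongr h.symm i)) }

variable [FiniteDimensional ℝ T] {N : ℕ}

/-- The Hodge operator `Λ^p T* → Λ^q T*`, `p + q = N = dim T`, of a nondegenerate symmetric
bilinear form `g` on `T` and the volume form `vol`:
`*α = (1/p!) ∑ α_{i_1 ⋯ i_p} i^{i_p} ⋯ i^{i_1} vol`. The right-hand side does not depend on the
basis in which the components are taken. -/
def hodge (g : LinearMap.BilinForm ℝ T) (vol : T [⋀^Fin N]→L[ℝ] ℝ) {p q : ℕ} (h : q + p = N)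
    (α : T [⋀^Fin p]→L[ℝ] ℝ) : T [⋀^Fin q]→L[ℝ] ℝ :=
  let b := Module.finBasis ℝ T
  ((p.factorial : ℝ))⁻¹ • ∑ I : Fin p → Fin (Module.finrank ℝ T),
    α (fun k => b (I k)) •
      contract p (fun k => raised g b (I k)) (reindex h vol)

/-- The inverse `*⁻¹ : Λ^q T* → Λ^p T*` of the Hodge operator `* : Λ^p T* → Λ^q T*`. -/
def hodgeInv (g : LinearMap.BilinForm ℝ T) (vol : T [⋀^Fin N]→L[ℝ] ℝ) {p q : ℕ} (h : q + p = N) :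
    T [⋀^Fin q]→L[ℝ] ℝ → T [⋀^Fin p]→L[ℝ] ℝ :=
  Function.invFun (hodge g vol h)

end LinearAlgebra

/-! ### Differential forms on the ambient space -/

/-- The ambient space `ℝ^{n+1}` with coordinates `y^0, …, y^n`. -/
abbrev E (n : ℕ) : Type := Fin (n + 1) → ℝ

/-- The diagonal entries of `diag(+,-,…,-,-ε)`. -/
def etaCoeff (n : ℕ) (ε : ℝ) (A : Fin (n + 1)) : ℝ :=
  if A = 0 then 1 else if A = Fin.last n then -ε else -1

/-- The ambient metric `η = diag(+,-,…,-,-ε)`. -/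
def eta (n : ℕ) (ε : ℝ) : LinearMap.BilinForm ℝ (E n) :=
  Matrix.toBilin' (Matrix.diagonal (etaCoeff n ε))

/-- The component `η^{nn}` of the inverse metric. -/
def etaUpNN (n : ℕ) (ε : ℝ) : ℝ := (etaCoeff n ε (Fin.last n))⁻¹

/-- The volume form `dy^0 ∧ ⋯ ∧ dy^n` of the oriented space `(ℝ^{n+1}, η)`. -/
def vol (n : ℕ) : E n [⋀^Fin (n + 1)]→L[ℝ] ℝ :=
  { (Matrix.detRowAlternating : E n [⋀^Fin (n + 1)]→ₗ[ℝ] ℝ) with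
    cont := Continuous.matrix_det continuous_id }

/-- Fields of `a`-covectors on the ambient space (`a`-forms, when smooth). -/
abbrev Form (n a : ℕ) : Type := E n → E n [⋀^Fin a]→L[ℝ] ℝ

/-- The exterior derivative from degree `a - 1` to degree `a`; forms of degree `-1` are zero. -/
def dPred {n : ℕ} : {a : ℕ} → Form n (a - 1) → Form n a
  | 0, _ => 0
  | _ + 1, β => extDeriv β

/-- The interior product `i_v α` in positive degree. -/
def intProdSucc {n a : ℕ} (v : E n → E n) (α : Form n (a + 1)) : Form n a :=
  fun y => (α y).curryLeft (v y)

/-- The interior product `i_v α`; it is zero on functions. -/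
def intProd {n : ℕ} (v : E n → E n) : {a : ℕ} → Form n a → Form n (a - 1)
  | 0, _ => 0
  | _ + 1, α => intProdSucc v α

/-- The Lie derivative of forms, `ℒ_v = i_v d + d i_v`. -/
def lieD {n a : ℕ} (v : E n → E n) (α : Form n a) : Form n a :=
  intProdSucc v (extDeriv α) + dPred (intProd v α)

/-- The Hodge operator of the ambient space. -/
def hodgeE {n : ℕ} (ε : ℝ) {a q : ℕ} (h : q + a = n + 1) (α : Form n a) : Form n q :=
  fun y => hodge (eta n ε) (vol n) h (α y)

/-- The codifferential `δα = (-1)^a *⁻¹ d * α` of the ambient space in positive degree. It is zero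
on degrees above the dimension, where all forms vanish. -/
def codiffSucc (n : ℕ) (ε : ℝ) {a : ℕ} (α : Form n (a + 1)) : Form n a :=
  if h : a + 1 ≤ n + 1 then fun y =>
    (-1 : ℝ) ^ (a + 1) •
      hodgeInv (eta n ε) (vol n) (p := a) (q := n + 1 - (a + 1) + 1) (by omega)
        (extDeriv (hodgeE ε (Nat.sub_add_cancel h) α) y)
  else 0

/-- The codifferential of the ambient space; it is zero on functions. -/
def codiff (n : ℕ) (ε : ℝ) : {a : ℕ} → Form n a → Form n (a - 1)
  | 0, _ => 0
  | _ + 1, α => codiffSucc n ε α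

/-- The Laplace-de Rham operator `□ = -(dδ + δd)` of the ambient space. -/
def box (n : ℕ) (ε : ℝ) {a : ℕ} (α : Form n a) : Form n a :=
  -(dPred (codiff n ε α) + codiffSucc n ε (extDeriv α))

/-- The function `h = 1 / √|y²|`. -/
def hfun (n : ℕ) (ε : ℝ) (y : E n) : ℝ := (√|eta n ε y y|)⁻¹

/-- The vector field `e_n = h D`, with `D = y^A ∂_A`, on `{y² ≠ 0}`; on the (anti-)de Sitter
space it is the exterior unit normal. -/
def eN (n : ℕ) (ε : ℝ) (y : E n) : E n := hfun n ε y • y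

/-! ### The (anti-)de Sitter space and its differential forms -/

/-- The (anti-)de Sitter space `y² = -ε H⁻²`. -/
def Sig (n : ℕ) (ε H : ℝ) : Set (E n) := {y | eta n ε y y = -ε * (H ^ 2)⁻¹}

/-- The tangent space at `p` of the level set of `y²` through `p`: the `η`-orthogonal complement
of `p`, that is, the kernel of the differential `2 η(p, ·)` of `y²`. -/
abbrev Tan (n : ℕ) (ε : ℝ) (p : E n) : Submodule ℝ (E n) := LinearMap.ker (eta n ε p)

/-- Fields of `a`-covectors on the (anti-)de Sitter space. -/
abbrev SForm (n : ℕ) (ε H : ℝ) (a : ℕ) : Type :=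
  ∀ p : Sig n ε H, Tan n ε (p : E n) [⋀^Fin a]→L[ℝ] ℝ

/-- The pullback `m*` by the inclusion of the (anti-)de Sitter space in the ambient space, whose
differential at `p` is the inclusion of the tangent space. -/
def restr {n : ℕ} (ε H : ℝ) {a : ℕ} (α : Form n a) : SForm n ε H a :=
  fun p => (α p).compContinuousLinearMap (Tan n ε (p : E n)).subtypeL

/-- The metric induced on the tangent space at `p`. -/
def metricS (n : ℕ) (ε : ℝ) (p : E n) : LinearMap.BilinForm ℝ (Tan n ε p) :=
  (eta n ε).domRestrict₁₂ (Tan n ε p) (Tan n ε p)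

/-- The volume form of the (anti-)de Sitter space, oriented by its exterior normal `e_n`: a frame
`(v_0, …, v_{n-1})` is direct when `(v_0, …, v_{n-1}, e_n)` is. Moving `e_n` to the first place
gives the sign: `volS (v_0, …, v_{n-1}) = vol (v_0, …, v_{n-1}, e_n)`. -/
def volS (n : ℕ) (ε : ℝ) (p : E n) : Tan n ε p [⋀^Fin n]→L[ℝ] ℝ :=
  (-1 : ℝ) ^ n •
    ((vol n).curryLeft (eN n ε p)).compContinuousLinearMap (Tan n ε p).subtypeL

/-- The pullback of a form on the (anti-)de Sitter space by a differentiable map `φ` to that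
space. At a point near which `φ` takes its values in the (anti-)de Sitter space, the differential
of `φ` automatically takes its values in the tangent space; elsewhere the value is `0`. -/
def pullS {n : ℕ} {ε H : ℝ} {F : Type*} [NormedAddCommGroup F] [NormedSpace ℝ F] {a : ℕ}
    (φ : F → E n) (β : SForm n ε H a) : F → F [⋀^Fin a]→L[ℝ] ℝ :=
  open Classical in fun v =>
    if h : φ v ∈ Sig n ε H ∧ ∀ u, fderiv ℝ φ v u ∈ Tan n ε (φ v) then
      (β ⟨φ v, h.1⟩).compContinuousLinearMap ((fderiv ℝ φ v).codRestrict (Tan n ε (φ v)) h.2)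
    else 0

/-- The local parametrization of the (anti-)de Sitter space around its point `p` by the tangent
space at `p`, namely the inverse of the orthogonal projection along `p`. It is defined on the
neighbourhood `1 + ε H² η(v, v) > 0` of `0`, it sends `0` to `p`, and its differential at `0` is
the inclusion of the tangent space. -/
def param {n : ℕ} {ε H : ℝ} (p : Sig n ε H) (v : Tan n ε (p : E n)) : E n :=
  (v : E n) + √(1 + ε * H ^ 2 * eta n ε v v) • (p : E n)

/-- The exterior derivative of the (anti-)de Sitter space: at `p` it is computed in the chart
around `p` that is given by `param p`, in which the tangent space at `p` is its own coordinate
space. -/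
def dS {n : ℕ} {ε H : ℝ} {a : ℕ} (β : SForm n ε H a) : SForm n ε H (a + 1) :=
  fun p => extDeriv (pullS (param p) β) 0

/-- `dS` from degree `a - 1` to degree `a`; forms of degree `-1` are zero. -/
def dPredS {n : ℕ} {ε H : ℝ} : {a : ℕ} → SForm n ε H (a - 1) → SForm n ε H a
  | 0, _ => 0
  | _ + 1, β => dS β

/-- The Hodge operator of the (anti-)de Sitter space. -/
def hodgeS {n : ℕ} {ε H : ℝ} {a q : ℕ} (h : q + a = n) (β : SForm n ε H a) : SForm n ε H q :=
  fun p => hodge (metricS n ε p) (volS n ε p) h (β p)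

/-- The codifferential `δα = (-1)^a *⁻¹ d * α` of the (anti-)de Sitter space in positive degree. It
is zero on degrees above the dimension, where all forms vanish. -/
def codiffSuccS {n : ℕ} {ε H : ℝ} {a : ℕ} (β : SForm n ε H (a + 1)) : SForm n ε H a :=
  if h : a + 1 ≤ n then fun p =>
    (-1 : ℝ) ^ (a + 1) •
      hodgeInv (metricS n ε p) (volS n ε p) (p := a) (q := n - (a + 1) + 1) (by omega)
        (dS (hodgeS (Nat.sub_add_cancel h) β) p)
  else 0

/-- The codifferential of the (anti-)de Sitter space; it is zero on functions. -/
def codiffS {n : ℕ} {ε H : ℝ} : {a : ℕ} → SForm n ε H a → SForm n ε H (a - 1)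
  | 0, _ => 0
  | _ + 1, β => codiffSuccS β

/-- The Laplace-de Rham operator `□ = -(dδ + δd)` of the (anti-)de Sitter space. -/
def boxS {n : ℕ} {ε H : ℝ} {a : ℕ} (β : SForm n ε H a) : SForm n ε H a :=
  -(dPredS (codiffS β) + codiffSuccS (dS β))

end AdS

end

open AdS

/-!
The proof rests on the formula `δ = -tr ∇`, valid for a metric and a volume form that are constant
to first order at the point considered. Its algebraic part is `alternatize_hodge`: for a linear map
`A` with values in forms, the alternation of `* ∘ A` is, up to sign, `*` of the trace of `A`. This
comes from the vanishing of `l ∧ vol` for covectors `l` (`sum_concat_eq_neg`). The same identity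
shows that `*` is injective, so that `*⁻¹` is a genuine inverse.

The formula gives `δ` on the flat ambient space at once (`codiffSucc_eq`). On the (anti-)de Sitter
space, the chart `param p` around `p` has a second derivative at `0` that is normal to the tangent
space, namely `(v, u) ↦ ε H² η(v, u) p`. Hence metric and volume form are stationary at `0` in this
chart (`hasFDerivAt_chartMetric`, `hasFDerivAt_chartVol`), and `δ_Σ` is again minus a trace, now of
the derivative of the pullback of the form by `param p` (`codiffSuccS_restr`). This derivative
contains the second derivative of `param p`, which contributes a multiple of `(n - a) i_p α`
when `α` has degree `a + 1` (`traceForm_pullDeriv`).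

The ambient trace is the tangential one plus the normal term `(∇_p α)(p, ·)` (`sum_raised_eta`).
Since `e_n` is radial with derivative `H` on tangent vectors and `0` on the normal,
`ℒ_n = ∇_n + aH` on tangent arguments of an `a`-form (`lieD_apply`), which turns the normal term
into `ℒ_n i_n α`. This proves the formula for `δ` (`restr_codiffSucc_eq_sub_lieD`).

The formula for `□` is the formula for `δ` used twice: applied to `dα`, and differentiated
(`dPredS_codiffS_restr`), where `d` commutes with the restriction and with `ℒ_n`. The two results
are combined by means of `ℒ_n α = i_n dα + d i_n α`.
-/

noncomputable section

namespace AdS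

/-! ### Concatenated tuples and iterated contractions -/

section Concat

variable {T : Type*}

/-- The tuple `(u_0, …, u_{p-1}, x_0, …, x_{q-1})`, of length `N = q + p`. A proof of this equation
is an argument, so that no casts between equal lengths are needed. -/
def concat {p q N : ℕ} (h : q + p = N) (u : Fin p → T) (x : Fin q → T) : Fin N → T :=
  fun i => if hi : i.1 < p then u ⟨i, hi⟩ else x ⟨i - p, by omega⟩

theorem concat_left {p q N : ℕ} (h : q + p = N) (u : Fin p → T) (x : Fin q → T) {i : Fin N}
    (k : Fin p) (hi : (i : ℕ) = k) : concat h u x i = u k := by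
  simp [concat, hi]

theorem concat_right {p q N : ℕ} (h : q + p = N) (u : Fin p → T) (x : Fin q → T) {i : Fin N}
    (j : Fin q) (hi : (i : ℕ) = p + j) : concat h u x i = x j := by
  simp [concat, hi]

theorem concat_zero {q N : ℕ} (h : q + 0 = N) (u : Fin 0 → T) (x : Fin q → T) :
    concat h u x = fun i => x (Fin.cast h.symm i) := by
  ext i
  simp [concat, Fin.cast]

theorem concat_succ {p q : ℕ} (u : Fin (p + 1) → T) (x : Fin q → T) :
    concat (N := q + (p + 1)) rfl u x =
      Matrix.vecCons (u 0) (concat (N := q + p) rfl (Fin.tail u) x) := by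
  ext i
  refine Fin.cases ?_ (fun i => ?_) i
  · simp [concat]
  · simp only [concat, Fin.val_succ, Nat.add_lt_add_iff_right, Matrix.cons_val_succ]
    split_ifs with h
    · rfl
    · congr 1
      ext
      simp

theorem map_concat {S F : Type*} [FunLike F T S] (f : F) {p q N : ℕ} (h : q + p = N)
    (u : Fin p → T) (x : Fin q → T) :
    (fun i => f (concat h u x i)) = concat h (fun i => f (u i)) (fun i => f (x i)) := by
  ext i
  simp only [concat]
  split_ifs <;> rfl

/-- Omitting an entry of the left part of the tuple `(u, x)`. -/
theorem concat_removeNth_left {p q N : ℕ} (h : q + p = N) (u : Fin (p + 1) → T) (x : Fin q → T)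
    (k : Fin (p + 1)) (k' : Fin (N + 1)) (hk : (k' : ℕ) = k) :
    k'.removeNth (concat (N := N + 1) (by omega) u x) = concat h (k.removeNth u) x := by
  ext i
  by_cases hi : i.1 < p
  · rw [concat_left h _ _ ⟨i, hi⟩ rfl, Fin.removeNth, concat_left _ _ _ (k.succAbove ⟨i, hi⟩)]
    · rfl
    · simp only [Fin.succAbove, Fin.lt_def, Fin.val_castSucc, hk]
      split_ifs <;> rfl
  · rw [concat_right h _ _ ⟨i - p, by omega⟩ (by simp only; omega), Fin.removeNth,
      concat_right _ _ _ ⟨i - p, by omega⟩]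
    simp only [Fin.succAbove, Fin.lt_def, Fin.val_castSucc, hk]
    split_ifs <;> simp <;> omega

/-- Omitting an entry of the right part of the tuple `(u, x)`. -/
theorem concat_removeNth_right {p q N : ℕ} (h : q + p = N) (u : Fin p → T) (x : Fin (q + 1) → T)
    (j : Fin (q + 1)) (j' : Fin (N + 1)) (hj : (j' : ℕ) = p + j) :
    j'.removeNth (concat (N := N + 1) (by omega) u x) = concat h u (j.removeNth x) := by
  ext i
  by_cases hi : i.1 < p
  · rw [concat_left h _ _ ⟨i, hi⟩ rfl, Fin.removeNth, concat_left _ _ _ ⟨i, hi⟩]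
    simp only [Fin.succAbove, Fin.lt_def, Fin.val_castSucc, hj]
    split_ifs <;> simp <;> omega
  · have hip : i.1 - p < q := by omega
    rw [concat_right h _ _ ⟨i - p, hip⟩ (by simp only; omega), Fin.removeNth,
      concat_right _ _ _ (j.succAbove ⟨i - p, hip⟩)]
    · rfl
    · simp only [Fin.succAbove, Fin.lt_def, Fin.val_castSucc, hj]
      split_ifs <;> simp <;> omega

theorem sum_fin_split {p q N : ℕ} (h : q + p = N) (f : Fin (N + 1) → ℝ) :
    ∑ i, f i = ∑ k : Fin p, f ⟨k, by omega⟩ + ∑ j : Fin (q + 1), f ⟨p + j, by omega⟩ := by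
  have h' : p + (q + 1) = N + 1 := by omega
  rw [← (finCongr h').sum_comp, Fin.sum_univ_add]
  rfl

end Concat

section LinearAlgebra

variable {T : Type*} [NormedAddCommGroup T] [NormedSpace ℝ T]

theorem contract_apply {q : ℕ} : ∀ (p : ℕ) (u : Fin p → T) (w : T [⋀^Fin (q + p)]→L[ℝ] ℝ)
    (x : Fin q → T), contract p u w x = w (concat rfl u x)
  | 0, u, w, x => by rw [concat_zero]; rfl
  | p + 1, u, w, x => by
    rw [contract, contract_apply p, concat_succ]; rfl

theorem reindex_apply {M N : ℕ} (h : M = N) (w : T [⋀^Fin N]→L[ℝ] ℝ) (x : Fin M → T) :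
    reindex h w x = w (fun i => x (Fin.cast h.symm i)) := rfl

theorem contract_reindex_apply {p q N : ℕ} (h : q + p = N) (u : Fin p → T)
    (w : T [⋀^Fin N]→L[ℝ] ℝ) (x : Fin q → T) :
    contract p u (reindex h w) x = w (concat h u x) := by
  subst h
  rw [contract_apply, reindex_apply]
  rfl

end LinearAlgebra

/-! ### Forms of top degree and raising of indices -/

section LinearAlgebra

variable {T : Type*} [NormedAddCommGroup T] [NormedSpace ℝ T]

theorem alternating_eq_zero_of_finrank_lt [FiniteDimensional ℝ T] {m : ℕ}
    (hm : Module.finrank ℝ T < m) (w : T [⋀^Fin m]→L[ℝ] ℝ) : w = 0 := by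
  ext v
  refine w.toAlternatingMap.map_linearDependent v fun hv => ?_
  have := hv.fintype_card_le_finrank
  simp at this
  omega

/-- A Plücker relation: `l ∧ w = 0` for a covector `l` and a form `w` of top degree. Evaluating
this on the tuple `(u, v)` and separating the terms where `l` takes an entry of `v` from those where
it takes an entry of `u` moves an alternation over `v` to one over `u`. -/
theorem sum_concat_eq_neg [FiniteDimensional ℝ T] {p q N : ℕ} (hN : Module.finrank ℝ T = N)
    (h : q + (p + 1) = N) (w : T [⋀^Fin N]→L[ℝ] ℝ) (l : T →L[ℝ] ℝ)
    (u : Fin (p + 1) → T) (v : Fin (q + 1) → T) :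
    ∑ j : Fin (q + 1), (-1) ^ (j : ℕ) * (l (v j) * w (concat h u (j.removeNth v))) =
      (-1) ^ p * ∑ k : Fin (p + 1), (-1) ^ (k : ℕ) *
        (l (u k) * w (concat (by omega) (k.removeNth u) v)) := by
  have h0 := DFunLike.congr_fun (alternating_eq_zero_of_finrank_lt (m := N + 1) (by omega)
    (ContinuousAlternatingMap.alternatizeUncurryFin (l.smulRight w)))
    (concat (N := N + 1) (by omega) u v)
  rw [ContinuousAlternatingMap.alternatizeUncurryFin_apply, sum_fin_split h] at h0
  have e1 : ∀ k : Fin (p + 1), concat (N := N + 1) (by omega) u v ⟨k, by omega⟩ = u k :=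
    fun k => concat_left _ _ _ k rfl
  have e2 : ∀ j : Fin (q + 1),
      concat (N := N + 1) (by omega) u v ⟨p + 1 + j, by omega⟩ = v j :=
    fun j => concat_right _ _ _ j rfl
  have e3 : ∀ k : Fin (p + 1), Fin.removeNth ⟨k, by omega⟩ (concat (N := N + 1) (by omega) u v) =
      concat (N := N) (by omega) (k.removeNth u) v :=
    fun k => concat_removeNth_left _ _ _ k _ rfl
  have e4 : ∀ j : Fin (q + 1), Fin.removeNth ⟨p + 1 + j, by omega⟩
      (concat (N := N + 1) (by omega) u v) = concat h u (j.removeNth v) :=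
    fun j => concat_removeNth_right h _ _ j _ rfl
  simp only [ContinuousLinearMap.smulRight_apply, ContinuousAlternatingMap.smul_apply,
    ContinuousAlternatingMap.coe_zero, Pi.zero_apply, smul_eq_mul, e1, e2, e3, e4] at h0
  have e : ∀ j : Fin (q + 1), ((-1 : ℝ)) ^ (j : ℕ) =
      (-1) ^ (p + 1) * (-1) ^ (p + 1 + (j : ℕ)) := fun j => by
    rw [pow_add _ (p + 1), ← mul_assoc, ← mul_pow]; simp
  simp only [zsmul_eq_mul, Int.cast_pow, Int.cast_neg, Int.cast_one] at h0
  simp_rw [e, mul_assoc, ← Finset.mul_sum]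
  rw [add_comm, ← eq_neg_iff_add_eq_zero] at h0
  rw [h0, pow_succ]
  ring

section Raised

variable {ι κ : Type*} [Fintype ι] [DecidableEq ι] [Fintype κ] [DecidableEq κ]
  {g : LinearMap.BilinForm ℝ T}

/-- The Gram matrix of a nondegenerate form is invertible; until this is known, the inverse matrix
in `raised` is a junk value. -/
theorem gram_det_ne_zero (hg : ∀ x, (∀ y, g x y = 0) → x = 0) (b : Module.Basis ι ℝ T) :
    (Matrix.of fun k l => g (b k) (b l)).det ≠ 0 := by
  intro h0
  obtain ⟨v, hv, hv0⟩ := Matrix.exists_vecMul_eq_zero_iff.2 h0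
  have hx : ∑ k, v k • b k = 0 := by
    refine hg _ fun y => ?_
    suffices h : g (∑ k, v k • b k) = 0 by rw [h]; rfl
    refine b.ext fun l => ?_
    have := congrFun hv0 l
    simpa [Matrix.vecMul, dotProduct] using this
  exact hv (funext fun k => by
    simpa using Fintype.linearIndependent_iff.1 b.linearIndependent v hx k)

/-- The vectors `raised g b i` are the basis that is `g`-dual to `b`. -/
theorem raised_left (hg : ∀ x, (∀ y, g x y = 0) → x = 0) (b : Module.Basis ι ℝ T) (i k : ι) :
    g (raised g b i) (b k) = if i = k then 1 else 0 := by
  have := congrFun (congrFun (Matrix.nonsing_inv_mul (Matrix.of fun k l => g (b k) (b l))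
    (isUnit_iff_ne_zero.2 (gram_det_ne_zero hg b))) i) k
  simpa [raised, Matrix.mul_apply, Matrix.one_apply] using this

theorem sum_raised_smul (hg : ∀ x, (∀ y, g x y = 0) → x = 0) (b : Module.Basis ι ℝ T) (x : T) :
    ∑ i, g (raised g b i) x • b i = x := by
  conv_lhs =>
    enter [2, i]
    rw [← b.sum_repr x]
  simp only [map_sum, map_smul, raised_left hg]
  simp [b.sum_repr x]

theorem sum_smul_raised (hs : ∀ x y, g x y = g y x) (hg : ∀ x, (∀ y, g x y = 0) → x = 0)
    (b : Module.Basis ι ℝ T) (x : T) : ∑ i, g (b i) x • raised g b i = x := by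
  rw [← sub_eq_zero]
  refine hg _ fun y => ?_
  suffices h : g (∑ i, g (b i) x • raised g b i - x) = 0 by rw [h]; rfl
  refine b.ext fun l => ?_
  simp [raised_left hg, hs x]

/-- The contraction of a bilinear map with the inverse metric does not depend on the basis. -/
theorem sum_raised_eq {F : Type*} [AddCommGroup F] [Module ℝ F]
    (hs : ∀ x y, g x y = g y x) (hg : ∀ x, (∀ y, g x y = 0) → x = 0)
    (b : Module.Basis ι ℝ T) (c : Module.Basis κ ℝ T) (B : T →ₗ[ℝ] T →ₗ[ℝ] F) :
    ∑ i, B (raised g b i) (b i) = ∑ k, B (raised g c k) (c k) := by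
  calc ∑ i, B (raised g b i) (b i)
      = ∑ i, ∑ k, B (g (b i) (raised g c k) • raised g b i) (c k) := by
        refine Finset.sum_congr rfl fun i _ => ?_
        conv_lhs => rw [← sum_raised_smul hg c (b i)]
        simp [hs (b i)]
    _ = _ := by
        rw [Finset.sum_comm]
        refine Finset.sum_congr rfl fun k _ => ?_
        conv_rhs => rw [← sum_smul_raised hs hg b (raised g c k)]
        simp

end Raised

end LinearAlgebra

/-! ### The Hodge operator and the trace -/

section Contraction

variable {T : Type*} [NormedAddCommGroup T] [NormedSpace ℝ T] {g : LinearMap.BilinForm ℝ T}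
  {ι κ : Type*} [Fintype ι] [DecidableEq ι] [Fintype κ] [DecidableEq κ]

/-- The first of the `p + 1` contracted pairs of arguments, split off from the others. -/
theorem sum_basis_contract_succ (b : Module.Basis ι ℝ T) {p q : ℕ} (x : Fin q → T)
    (α : T [⋀^Fin (p + 1)]→L[ℝ] ℝ) (w : T [⋀^Fin (q + (p + 1))]→L[ℝ] ℝ) :
    ∑ I : Fin (p + 1) → ι, α (fun k => b (I k)) * w (concat rfl (fun k => raised g b (I k)) x) =
      ∑ m, ∑ J : Fin p → ι, α.curryLeft (b m) (fun k => b (J k)) *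
        w.curryLeft (raised g b m) (concat rfl (fun k => raised g b (J k)) x) := by
  rw [← (Fin.consEquiv fun _ => ι).sum_comp, Fintype.sum_prod_type]
  refine Finset.sum_congr rfl fun m _ => Finset.sum_congr rfl fun J _ => ?_
  rw [concat_succ]
  congr 1
  rw [ContinuousAlternatingMap.curryLeft_apply_apply]
  congr 1
  ext i
  refine Fin.cases ?_ (fun i => ?_) i <;> simp [Fin.consEquiv]

/-- The contraction of all arguments of `α` with the first arguments of `w` does not depend on the
basis: change the basis in one pair of arguments at a time. -/
theorem sum_basis_contract_eq (hs : ∀ x y, g x y = g y x) (hg : ∀ x, (∀ y, g x y = 0) → x = 0)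
    (b : Module.Basis ι ℝ T) (c : Module.Basis κ ℝ T) {q : ℕ} (x : Fin q → T) :
    ∀ (p : ℕ) (α : T [⋀^Fin p]→L[ℝ] ℝ) (w : T [⋀^Fin (q + p)]→L[ℝ] ℝ),
      ∑ I : Fin p → ι, α (fun k => b (I k)) * w (concat rfl (fun k => raised g b (I k)) x) =
      ∑ I : Fin p → κ, α (fun k => c (I k)) * w (concat rfl (fun k => raised g c (I k)) x)
  | 0, α, w => by
    rw [Fintype.sum_unique, Fintype.sum_unique]
    congr 2
    exact Subsingleton.elim _ _
  | p + 1, α, w => by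
    let B : T →ₗ[ℝ] T →ₗ[ℝ] ℝ := LinearMap.mk₂ ℝ
      (fun y z => ∑ J : Fin p → ι, α.curryLeft z (fun k => b (J k)) *
          w.curryLeft y (concat rfl (fun k => raised g b (J k)) x))
      (fun y₁ y₂ z => by
        simp only [map_add, ContinuousAlternatingMap.add_apply, mul_add, Finset.sum_add_distrib])
      (fun r y z => by
        simp only [map_smul, ContinuousAlternatingMap.smul_apply, smul_eq_mul, mul_left_comm _ r,
          Finset.mul_sum])
      (fun y z₁ z₂ => by
        simp only [map_add, ContinuousAlternatingMap.add_apply, add_mul, Finset.sum_add_distrib])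
      (fun r y z => by
        simp only [map_smul, ContinuousAlternatingMap.smul_apply, smul_eq_mul, mul_assoc,
          Finset.mul_sum])
    have hB := sum_raised_eq hs hg b c B
    simp only [B, LinearMap.mk₂_apply] at hB
    rw [sum_basis_contract_succ, sum_basis_contract_succ, hB]
    exact Finset.sum_congr rfl fun m _ => sum_basis_contract_eq hs hg b c x p _ _

end Contraction

section Hodge

variable {T : Type*} [NormedAddCommGroup T] [NormedSpace ℝ T] [FiniteDimensional ℝ T]
  {g : LinearMap.BilinForm ℝ T} {N : ℕ}

theorem hodge_apply (g : LinearMap.BilinForm ℝ T) (w : T [⋀^Fin N]→L[ℝ] ℝ) {p q : ℕ}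
    (h : q + p = N) (α : T [⋀^Fin p]→L[ℝ] ℝ) (x : Fin q → T) :
    hodge g w h α x = (p.factorial : ℝ)⁻¹ * ∑ I : Fin p → Fin (Module.finrank ℝ T),
      α (fun k => Module.finBasis ℝ T (I k)) *
        w (concat h (fun k => raised g (Module.finBasis ℝ T) (I k)) x) := by
  simp [hodge, ContinuousAlternatingMap.sum_apply, contract_reindex_apply]

/-- The Hodge operator as a continuous linear map. -/
def hodgeCLM (g : LinearMap.BilinForm ℝ T) (w : T [⋀^Fin N]→L[ℝ] ℝ) {p q : ℕ}
    (h : q + p = N) : (T [⋀^Fin p]→L[ℝ] ℝ) →L[ℝ] (T [⋀^Fin q]→L[ℝ] ℝ) :=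
  (p.factorial : ℝ)⁻¹ • ∑ I : Fin p → Fin (Module.finrank ℝ T),
    (ContinuousAlternatingMap.apply ℝ T ℝ (fun k => Module.finBasis ℝ T (I k))).smulRight
      (contract p (fun k => raised g (Module.finBasis ℝ T) (I k)) (reindex h w))

theorem hodgeCLM_apply (g : LinearMap.BilinForm ℝ T) (w : T [⋀^Fin N]→L[ℝ] ℝ) {p q : ℕ}
    (h : q + p = N) (α : T [⋀^Fin p]→L[ℝ] ℝ) : hodgeCLM g w h α = hodge g w h α := by
  simp [hodgeCLM, hodge]

/-- The Hodge operator may be computed in any basis, not only in `Module.finBasis`. -/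
theorem hodge_apply_basis {ι : Type*} [Fintype ι] [DecidableEq ι]
    (hs : ∀ x y, g x y = g y x) (hg : ∀ x, (∀ y, g x y = 0) → x = 0)
    (b : Module.Basis ι ℝ T) (w : T [⋀^Fin N]→L[ℝ] ℝ) {p q : ℕ}
    (h : q + p = N) (α : T [⋀^Fin p]→L[ℝ] ℝ) (x : Fin q → T) :
    hodge g w h α x = (p.factorial : ℝ)⁻¹ * ∑ I : Fin p → ι,
      α (fun k => b (I k)) * w (concat h (fun k => raised g b (I k)) x) := by
  subst h
  rw [hodge_apply, sum_basis_contract_eq hs hg (Module.finBasis ℝ T) b]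

/-- The Hodge operator is natural under linear isometries. -/
theorem hodge_comp_equiv {S : Type*} [NormedAddCommGroup S] [NormedSpace ℝ S]
    [FiniteDimensional ℝ S] {g' : LinearMap.BilinForm ℝ S} (e : T ≃L[ℝ] S)
    (he : ∀ x y, g' (e x) (e y) = g x y)
    (hs : ∀ x y, g' x y = g' y x) (hg : ∀ x, (∀ y, g' x y = 0) → x = 0)
    (w : S [⋀^Fin N]→L[ℝ] ℝ) {p q : ℕ} (h : q + p = N) (α : S [⋀^Fin p]→L[ℝ] ℝ) :
    (hodge g' w h α).compContinuousLinearMap (e : T →L[ℝ] S) =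
      hodge g (w.compContinuousLinearMap (e : T →L[ℝ] S)) h
        (α.compContinuousLinearMap (e : T →L[ℝ] S)) := by
  ext x
  have hr : ∀ i, raised g' ((Module.finBasis ℝ T).map e.toLinearEquiv) i =
      e (raised g (Module.finBasis ℝ T) i) := by
    intro i
    simp [raised, he, map_sum]
  rw [ContinuousAlternatingMap.compContinuousLinearMap_apply,
    hodge_apply_basis hs hg ((Module.finBasis ℝ T).map e.toLinearEquiv), hodge_apply]
  congr 1
  refine Finset.sum_congr rfl fun I _ => ?_
  simp only [ContinuousAlternatingMap.compContinuousLinearMap_apply, hr]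
  congr 2
  exact (map_concat e h _ _).symm

/-- The `g`-trace over the argument of `A` and the first argument of its values. -/
def traceForm (g : LinearMap.BilinForm ℝ T) {p : ℕ} (A : T →L[ℝ] T [⋀^Fin (p + 1)]→L[ℝ] ℝ) :
    T [⋀^Fin p]→L[ℝ] ℝ :=
  ∑ i, (A (raised g (Module.finBasis ℝ T) i)).curryLeft (Module.finBasis ℝ T i)

/-- The algebra behind the divergence formula: if `* ∘ A` is the derivative of a form `*α`, whose
alternation is the exterior derivative, then `d*α` is, up to sign, `*` of the trace of `A`. -/
theorem alternatize_hodge (hN : Module.finrank ℝ T = N) (w : T [⋀^Fin N]→L[ℝ] ℝ) {p q : ℕ}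
    (h : q + (p + 1) = N) (A : T →L[ℝ] T [⋀^Fin (p + 1)]→L[ℝ] ℝ) :
    ContinuousAlternatingMap.alternatizeUncurryFin (hodgeCLM g w h ∘L A) =
      (-1 : ℝ) ^ p • hodge g w (show q + 1 + p = N by omega) (traceForm g A) := by
  ext v
  set b := Module.finBasis ℝ T with hb
  have hk : ∀ k : Fin (p + 1), ∑ I : Fin (p + 1) → Fin (Module.finrank ℝ T),
      (-1 : ℝ) ^ (k : ℕ) * (A (raised g b (I k)) (fun j => b (I j)) *
        w (concat (show q + 1 + p = N by omega) (k.removeNth fun j => raised g b (I j)) v)) =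
      ∑ J : Fin p → Fin (Module.finrank ℝ T), traceForm g A (fun j => b (J j)) *
        w (concat (show q + 1 + p = N by omega) (fun j => raised g b (J j)) v) := by
    intro k
    rw [← (Fin.insertNthEquiv (fun _ => Fin (Module.finrank ℝ T)) k).sum_comp,
      Fintype.sum_prod_type, Finset.sum_comm]
    refine Finset.sum_congr rfl fun J _ => ?_
    rw [traceForm, ContinuousAlternatingMap.sum_apply, Finset.sum_mul]
    refine Finset.sum_congr rfl fun m _ => ?_
    have e1 : (fun j => b (k.insertNth (α := fun _ => Fin (Module.finrank ℝ T)) m J j)) =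
        k.insertNth (α := fun _ => T) (b m) (fun j => b (J j)) := by
      ext j
      refine Fin.succAboveCases k ?_ (fun j => ?_) j <;> simp
    have e2 : (k.removeNth fun j => raised g b
        (k.insertNth (α := fun _ => Fin (Module.finrank ℝ T)) m J j)) =
        fun j => raised g b (J j) := by
      ext j
      simp [Fin.removeNth]
    simp only [Fin.insertNthEquiv_apply, Fin.insertNth_apply_same]
    rw [e1, e2, ContinuousAlternatingMap.map_insertNth, zsmul_eq_mul, Int.cast_pow,
      Int.cast_neg, Int.cast_one, ← mul_assoc, ← mul_assoc,
      ← mul_pow]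
    simp [hb]
  rw [ContinuousAlternatingMap.alternatizeUncurryFin_apply]
  simp only [ContinuousLinearMap.comp_apply, hodgeCLM_apply, hodge_apply,
    ContinuousAlternatingMap.smul_apply, smul_eq_mul, zsmul_eq_mul, Int.cast_pow, Int.cast_neg,
    Int.cast_one, ← hb]
  calc _ = ((p + 1).factorial : ℝ)⁻¹ * ∑ I : Fin (p + 1) → Fin (Module.finrank ℝ T),
        ∑ j : Fin (q + 1), (-1 : ℝ) ^ (j : ℕ) * (A (v j) (fun k => b (I k)) *
          w (concat h (fun k => raised g b (I k)) (j.removeNth v))) := by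
        rw [Finset.sum_comm, Finset.mul_sum]
        refine Finset.sum_congr rfl fun j _ => ?_
        rw [Finset.mul_sum, Finset.mul_sum, Finset.mul_sum]
        exact Finset.sum_congr rfl fun I _ => by ring
    _ = ((p + 1).factorial : ℝ)⁻¹ * ∑ I : Fin (p + 1) → Fin (Module.finrank ℝ T),
        (-1 : ℝ) ^ p * ∑ k : Fin (p + 1), (-1 : ℝ) ^ (k : ℕ) *
          (A (raised g b (I k)) (fun j => b (I j)) *
            w (concat (show q + 1 + p = N by omega)
              (k.removeNth fun j => raised g b (I j)) v)) := by
        congr 1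
        refine Finset.sum_congr rfl fun I _ => ?_
        exact sum_concat_eq_neg hN h w
          ((ContinuousAlternatingMap.apply ℝ T ℝ (fun k => b (I k))) ∘L A) _ v
    _ = _ := by
        rw [← Finset.mul_sum, Finset.sum_comm, Finset.sum_congr rfl fun k _ => hk k]
        simp only [Finset.sum_const, Finset.card_univ, Fintype.card_fin, nsmul_eq_mul,
          Nat.factorial_succ, Nat.cast_mul]
        have : ((p + 1 : ℕ) : ℝ) ≠ 0 := by positivity
        have : ((p.factorial : ℕ) : ℝ) ≠ 0 := by positivity
        field_simp

/-- By induction on the degree `p` of `α`: applying `alternatize_hodge` to `g(X, ·) ⊗ α`, whose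
trace is `i_X α`, one obtains `* i_X α = 0` for all `X` from `* α = 0`. -/
theorem hodge_injective (hs : ∀ x y, g x y = g y x) (hg : ∀ x, (∀ y, g x y = 0) → x = 0)
    (hN : Module.finrank ℝ T = N) {w : T [⋀^Fin N]→L[ℝ] ℝ} (hw : w ≠ 0) :
    ∀ {p q : ℕ} (h : q + p = N) (α : T [⋀^Fin p]→L[ℝ] ℝ), hodge g w h α = 0 → α = 0
  | 0, q, h, α, h0 => by
    subst h
    obtain ⟨x, hx⟩ : ∃ x, w x ≠ 0 := by
      by_contra! hx
      exact hw (ContinuousAlternatingMap.ext hx)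
    have := DFunLike.congr_fun h0 x
    rw [hodge_apply, Fintype.sum_unique, concat_zero] at this
    ext v
    rw [Subsingleton.elim v fun k => Module.finBasis ℝ T ((default : Fin 0 → Fin _) k)]
    simpa [hx] using this
  | p + 1, q, h, α, h0 => by
    have hX : ∀ X, α.curryLeft X = 0 := by
      intro X
      refine hodge_injective hs hg hN hw (show q + 1 + p = N by omega) _ ?_
      have h1 := alternatize_hodge (g := g) hN w h
        ((LinearMap.toContinuousLinearMap (g X)).smulRight α)
      have h2 : hodgeCLM g w h ∘L (LinearMap.toContinuousLinearMap (g X)).smulRight α = 0 := by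
        ext1 y
        simp [hodgeCLM_apply, h0]
      have h3 : traceForm g ((LinearMap.toContinuousLinearMap (g X)).smulRight α) =
          α.curryLeft X := by
        conv_rhs => rw [← sum_raised_smul hg (Module.finBasis ℝ T) X]
        simp only [traceForm, ContinuousLinearMap.smulRight_apply,
          ContinuousAlternatingMap.curryLeft_smul, map_sum, map_smul]
        exact Finset.sum_congr rfl fun i _ => by simp [hs X]
      rw [h2, h3] at h1
      have h4 : ContinuousAlternatingMap.alternatizeUncurryFin
          (0 : T →L[ℝ] T [⋀^Fin q]→L[ℝ] ℝ) = 0 :=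
        map_zero (ContinuousAlternatingMap.alternatizeUncurryFinCLM ℝ T ℝ)
      rw [h4] at h1
      exact (smul_eq_zero.1 h1.symm).resolve_left (by simp)
    ext v
    have := DFunLike.congr_fun (hX (v 0)) (Fin.tail v)
    rw [ContinuousAlternatingMap.curryLeft_apply_apply] at this
    simpa [Matrix.vecCons] using this

/-- `hodgeInv` is defined by `Function.invFun`, so its values mean something only because `hodge`
is injective. -/
theorem hodgeInv_eq (hs : ∀ x y, g x y = g y x) (hg : ∀ x, (∀ y, g x y = 0) → x = 0)
    (hN : Module.finrank ℝ T = N) {w : T [⋀^Fin N]→L[ℝ] ℝ} (hw : w ≠ 0)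
    {p q : ℕ} (h : q + p = N) (α : T [⋀^Fin p]→L[ℝ] ℝ) :
    hodgeInv g w h (hodge g w h α) = α := by
  refine Function.leftInverse_invFun (fun α β hαβ => ?_) α
  rw [← sub_eq_zero]
  refine hodge_injective hs hg hN hw h _ ?_
  rw [← hodgeCLM_apply, map_sub, hodgeCLM_apply, hodgeCLM_apply, hαβ, sub_self]

end Hodge

section Hodge

variable {T : Type*} [NormedAddCommGroup T] [NormedSpace ℝ T] [FiniteDimensional ℝ T]
  {g : LinearMap.BilinForm ℝ T} {N : ℕ}

/-- The pointwise form of `δ = -tr ∇`: when `A` is the derivative of `α`, the left-hand side is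
`(-1)^{p+1} *⁻¹ d * α`, for a metric and a volume form that are constant to first order. -/
theorem hodgeInv_alternatize_hodge (hs : ∀ x y, g x y = g y x)
    (hg : ∀ x, (∀ y, g x y = 0) → x = 0) (hN : Module.finrank ℝ T = N)
    {w : T [⋀^Fin N]→L[ℝ] ℝ} (hw : w ≠ 0) {p q : ℕ} (h : q + (p + 1) = N)
    (A : T →L[ℝ] T [⋀^Fin (p + 1)]→L[ℝ] ℝ) :
    (-1 : ℝ) ^ (p + 1) • hodgeInv g w (show q + 1 + p = N by omega)
      (ContinuousAlternatingMap.alternatizeUncurryFin (hodgeCLM g w h ∘L A)) =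
        -traceForm g A := by
  rw [alternatize_hodge hN, ← hodgeCLM_apply, ← map_smul, hodgeCLM_apply,
    hodgeInv_eq hs hg hN hw, smul_smul, ← pow_add, show p + 1 + p = 2 * p + 1 by ring, pow_succ,
    pow_mul, neg_one_sq, one_pow, one_mul]
  exact neg_one_smul ℝ (traceForm g A)

theorem traceForm_eq_zero (hN : Module.finrank ℝ T = N) {p : ℕ} (hp : N < p + 1)
    (A : T →L[ℝ] T [⋀^Fin (p + 1)]→L[ℝ] ℝ) : traceForm g A = 0 := by
  simp only [traceForm]
  refine Finset.sum_eq_zero fun i _ => ?_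
  rw [alternating_eq_zero_of_finrank_lt (by omega) (A _)]
  rfl

end Hodge

/-! ### The ambient space -/

section Ambient

variable {n : ℕ} {ε : ℝ}

theorem eta_apply (x y : E n) : eta n ε x y = ∑ A, etaCoeff n ε A * (x A * y A) := by
  rw [eta, Matrix.toBilin'_apply']
  simp [dotProduct, Matrix.mulVec_diagonal, mul_left_comm]

theorem eta_symm (x y : E n) : eta n ε x y = eta n ε y x := by
  simp only [eta_apply, mul_comm (x _)]

theorem etaCoeff_ne_zero (hε : ε ≠ 0) (A : Fin (n + 1)) : etaCoeff n ε A ≠ 0 := by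
  unfold etaCoeff
  split_ifs <;> simp [hε]

theorem eta_nondegenerate (hε : ε ≠ 0) (x : E n) (hx : ∀ y, eta n ε x y = 0) : x = 0 := by
  ext A
  have := hx (Pi.single A 1)
  rw [eta_apply, Finset.sum_eq_single A] at this
  · simpa [etaCoeff_ne_zero hε] using this
  · intro B _ hB
    simp [hB]
  · simp

theorem vol_apply (x : Fin (n + 1) → E n) : vol n x = Matrix.det (Matrix.of x) := rfl

theorem vol_ne_zero : vol n ≠ 0 := by
  intro h
  have := DFunLike.congr_fun h (1 : Matrix (Fin (n + 1)) (Fin (n + 1)) ℝ)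
  change Matrix.det 1 = (0 : ℝ) at this
  simp at this

theorem vol_ne_zero_of_linearIndependent {x : Fin (n + 1) → E n} (hx : LinearIndependent ℝ x) :
    vol n x ≠ 0 := by
  rw [vol_apply]
  have : IsUnit (Matrix.of x) := Matrix.linearIndependent_rows_iff_isUnit.1 hx
  exact ((Matrix.isUnit_iff_isUnit_det _).1 this).ne_zero

theorem finrank_E : Module.finrank ℝ (E n) = n + 1 := by simp

/-- The codifferential of the flat ambient space is minus the trace of the derivative. It holds in
degrees above the dimension too, where both sides vanish. -/
theorem codiffSucc_eq (hε : ε ≠ 0) {a : ℕ} {α : Form n (a + 1)} {y : E n}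
    (hα : DifferentiableAt ℝ α y) :
    codiffSucc n ε α y = -traceForm (eta n ε) (fderiv ℝ α y) := by
  unfold codiffSucc
  split_ifs with h
  · beta_reduce
    have e : hodgeE ε (Nat.sub_add_cancel h) α =
        hodgeCLM (eta n ε) (vol n) (Nat.sub_add_cancel h) ∘ α := by
      ext1 z
      simp [hodgeE, hodgeCLM_apply]
    rw [e]
    unfold extDeriv
    beta_reduce
    rw [((hodgeCLM (eta n ε) (vol n) (Nat.sub_add_cancel h)).hasFDerivAt.comp y
      hα.hasFDerivAt).fderiv]
    exact hodgeInv_alternatize_hodge eta_symm (eta_nondegenerate hε) finrank_E vol_ne_zero _ _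
  · rw [traceForm_eq_zero finrank_E (by omega)]
    simp

end Ambient

/-! ### Linear algebra of the (anti-)de Sitter space -/

section Sphere

variable {n : ℕ} {ε H : ℝ}

theorem etaUpNN_eq (hn : 1 ≤ n) (hε : ε = 1 ∨ ε = -1) : etaUpNN n ε = -ε := by
  have : Fin.last n ≠ 0 := by
    intro h
    have := congrArg Fin.val h
    simp at this
    omega
  rw [etaUpNN, etaCoeff, if_neg this, if_pos rfl]
  rcases hε with rfl | rfl <;> norm_num

theorem eta_self (p : Sig n ε H) : eta n ε p p = -ε * (H ^ 2)⁻¹ := p.2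

theorem eta_self_ne_zero (hε : ε ≠ 0) (hH : 0 < H) (p : Sig n ε H) :
    eta n ε (p : E n) p ≠ 0 := by
  rw [eta_self]
  have := hH.ne'
  simp [hε, this]

theorem mem_Tan {p x : E n} : x ∈ Tan n ε p ↔ eta n ε p x = 0 := LinearMap.mem_ker

theorem eta_coe {p : E n} (x : Tan n ε p) : eta n ε p x = 0 := mem_Tan.1 x.2

theorem metricS_apply {p : E n} (x y : Tan n ε p) : metricS n ε p x y = eta n ε x y := rfl

theorem metricS_symm {p : E n} (x y : Tan n ε p) : metricS n ε p x y = metricS n ε p y x :=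
  eta_symm _ _

/-- The `η`-orthogonal projection along `p` takes its values in `Tan n ε p`. -/
theorem sub_smul_mem_Tan {p : E n} (hp : eta n ε p p ≠ 0) (x : E n) :
    x - (eta n ε p x / eta n ε p p) • p ∈ Tan n ε p := by
  rw [mem_Tan]
  simp [hp]

theorem metricS_nondegenerate (hε : ε ≠ 0) {p : E n} (hp : eta n ε p p ≠ 0) (x : Tan n ε p)
    (hx : ∀ y, metricS n ε p x y = 0) : x = 0 := by
  ext1
  refine eta_nondegenerate hε _ fun y => ?_
  have := hx ⟨_, sub_smul_mem_Tan hp y⟩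
  rw [metricS_apply] at this
  simpa [eta_symm (x : E n) p, eta_coe x] using this

theorem finrank_Tan {p : E n} (hp : eta n ε p p ≠ 0) : Module.finrank ℝ (Tan n ε p) = n := by
  have h0 : eta n ε p ≠ 0 := by
    intro h
    rw [h] at hp
    simp at hp
  have := Module.Dual.finrank_ker_add_one_of_ne_zero (f := eta n ε p) h0
  rw [finrank_E] at this
  exact Nat.add_right_cancel this

theorem eN_eq (hε : ε = 1 ∨ ε = -1) (hH : 0 < H) (p : Sig n ε H) :
    eN n ε p = H • (p : E n) := by
  have hH' := hH.ne'
  rw [eN, hfun, eta_self, abs_mul, abs_neg]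
  have : |ε| = 1 := by rcases hε with rfl | rfl <;> simp
  rw [this, one_mul, abs_of_pos (by positivity), Real.sqrt_inv, Real.sqrt_sq hH.le, inv_inv]

/-- A basis of the tangent space at `p` is completed by the normal to a basis of the ambient
space, on which `vol` does not vanish. -/
theorem volS_ne_zero (hε : ε = 1 ∨ ε = -1) (hH : 0 < H) (p : Sig n ε H) :
    volS n ε p ≠ 0 := by
  have hε0 : ε ≠ 0 := by rcases hε with rfl | rfl <;> norm_num
  have hp := eta_self_ne_zero hε0 hH p
  intro h0
  let b := Module.finBasisOfFinrankEq ℝ (Tan n ε (p : E n)) (finrank_Tan hp)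
  have h1 := DFunLike.congr_fun h0 fun i => b i
  rw [volS, eN_eq hε hH] at h1
  simp only [ContinuousAlternatingMap.smul_apply,
    ContinuousAlternatingMap.compContinuousLinearMap_apply,
    ContinuousAlternatingMap.curryLeft_apply_apply] at h1
  have h2 := (smul_eq_zero.1 h1).resolve_left (by simp)
  refine vol_ne_zero_of_linearIndependent ?_ h2
  refine LinearIndependent.finCons (b.linearIndependent.map' _ (Submodule.ker_subtype _)) ?_
  intro hmem
  have h3 : Submodule.span ℝ (Set.range ((Tan n ε (p : E n)).subtype ∘ b)) ≤ Tan n ε (p : E n) := by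
    rw [Submodule.span_le]
    rintro _ ⟨i, rfl⟩
    exact (b i).2
  have := mem_Tan.1 (h3 hmem)
  simp [hp, hH.ne'] at this

/-- The trace over the ambient space is the trace over the tangent space plus the contribution of
the normal `p`. -/
theorem sum_raised_eta (hε : ε ≠ 0) {p : E n} (hp : eta n ε p p ≠ 0) {F : Type*}
    [AddCommGroup F] [Module ℝ F] {ι κ : Type*} [Fintype ι] [DecidableEq ι] [Fintype κ]
    [DecidableEq κ] (c : Module.Basis κ ℝ (E n)) (b : Module.Basis ι ℝ (Tan n ε p))
    (B : E n →ₗ[ℝ] E n →ₗ[ℝ] F) :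
    ∑ A, B (raised (eta n ε) c A) (c A) =
      ∑ i, B (raised (metricS n ε p) b i : Tan n ε p) (b i) + (eta n ε p p)⁻¹ • B p p := by
  have hdec : ∀ x : E n, ∑ i, eta n ε x (raised (metricS n ε p) b i : Tan n ε p) • (b i : E n) +
      (eta n ε x p / eta n ε p p) • p = x := by
    intro x
    have h1 := congrArg Subtype.val (sum_raised_smul (metricS_nondegenerate hε hp) b
      ⟨_, sub_smul_mem_Tan hp x⟩)
    simp only [metricS_apply, Submodule.coe_sum, Submodule.coe_smul, map_sub, map_smul] at h1
    simp only [eta_symm _ p, eta_coe, smul_zero, sub_zero] at h1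
    simp only [eta_symm x]
    rw [h1]
    simp
  calc ∑ A, B (raised (eta n ε) c A) (c A)
      = ∑ A, (∑ i, B (eta n ε (c A) (raised (metricS n ε p) b i : Tan n ε p) •
            raised (eta n ε) c A) (b i) +
          (eta n ε p p)⁻¹ • B (eta n ε (c A) p • raised (eta n ε) c A) p) := by
        refine Finset.sum_congr rfl fun A _ => ?_
        conv_lhs => rw [← hdec (c A)]
        simp [smul_smul, div_eq_inv_mul]
    _ = _ := by
        rw [Finset.sum_add_distrib, Finset.sum_comm, ← Finset.smul_sum]
        congr 1
        · refine Finset.sum_congr rfl fun i _ => ?_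
          conv_rhs => rw [← sum_smul_raised eta_symm (eta_nondegenerate hε) c
            (raised (metricS n ε p) b i : Tan n ε p)]
          simp
        · have h1 := congrArg (fun z => B z p)
            (sum_smul_raised eta_symm (eta_nondegenerate hε) c p)
          simpa using congrArg ((eta n ε p p)⁻¹ • ·) h1

end Sphere

/-! ### Differentiating the Hodge operator -/

section Calculus

variable {T : Type*} [NormedAddCommGroup T] [NormedSpace ℝ T] [FiniteDimensional ℝ T]
  {S : Type*} [NormedAddCommGroup S] [NormedSpace ℝ S]

/-- In finite dimension, a family of alternating maps is differentiable as soon as its values at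
all tuples of vectors are: finitely many of them are linear coordinates. -/
theorem hasFDerivAt_of_apply {q : ℕ} {f : S → T [⋀^Fin q]→L[ℝ] ℝ}
    {f' : S →L[ℝ] T [⋀^Fin q]→L[ℝ] ℝ} {s : S}
    (h : ∀ x, HasFDerivAt (fun v => f v x) (ContinuousAlternatingMap.apply ℝ T ℝ x ∘L f') s) :
    HasFDerivAt f f' s := by
  let b := Module.finBasis ℝ T
  let ev : (T [⋀^Fin q]→L[ℝ] ℝ) →ₗ[ℝ] ((Fin q → Fin (Module.finrank ℝ T)) → ℝ) :=
    { toFun := fun w I => w fun k => b (I k)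
      map_add' := fun _ _ => rfl
      map_smul' := fun _ _ => rfl }
  have hev : LinearMap.ker ev = ⊥ := by
    rw [LinearMap.ker_eq_bot]
    intro w w' hw
    refine ContinuousAlternatingMap.toAlternatingMap_injective ?_
    exact b.ext_alternating fun I _ => congrFun hw I
  obtain ⟨L, hL⟩ := ev.exists_leftInverse_of_injective hev
  have hL' : ∀ w, L (ev w) = w := fun w => LinearMap.congr_fun hL w
  have h1 : HasFDerivAt (fun v => ev (f v)) (ContinuousLinearMap.pi fun I =>
      ContinuousAlternatingMap.apply ℝ T ℝ (fun k => b (I k)) ∘L f') s :=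
    hasFDerivAt_pi.2 fun I => h _
  have h2 := (LinearMap.toContinuousLinearMap L).hasFDerivAt.comp s h1
  have e1 : (LinearMap.toContinuousLinearMap L) ∘ (fun v => ev (f v)) = f := by
    ext1 v
    exact hL' _
  rw [e1] at h2
  convert! h2 using 1
  ext1 u
  exact (hL' _).symm

/-- The entries of the inverse matrix are differentiable functions of those of the matrix, by
Cramer's rule. -/
theorem differentiableAt_matrix_inv_apply {ι : Type*} [Fintype ι] [DecidableEq ι]
    {m : ι → ι → ℝ} (hm : (Matrix.of m).det ≠ 0) (i j : ι) :
    DifferentiableAt ℝ (fun m : ι → ι → ℝ => (Matrix.of m)⁻¹ i j) m := by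
  have hdet : Differentiable ℝ fun m : ι → ι → ℝ => (Matrix.of m).det := by
    simp only [Matrix.det_apply, Matrix.of_apply]
    fun_prop
  have hadj : Differentiable ℝ fun m : ι → ι → ℝ => (Matrix.of m).adjugate i j := by
    have e : ∀ m : ι → ι → ℝ, (Matrix.of m).adjugate i j =
        (Matrix.of fun k l => if k = j then (Pi.single i 1 : ι → ℝ) l else m k l).det := by
      intro m
      rw [Matrix.adjugate_apply]
      congr 1
      ext k l
      simp [Matrix.updateRow_apply]
    simp only [e]
    refine hdet.comp (f := fun (m : ι → ι → ℝ) k l =>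
      if k = j then (Pi.single i 1 : ι → ℝ) l else m k l) ?_
    refine differentiable_pi.2 fun k => differentiable_pi.2 fun l => ?_
    split_ifs <;> fun_prop
  simp only [Matrix.inv_def, Ring.inverse_eq_inv', Matrix.smul_apply, smul_eq_mul]
  exact (hdet.differentiableAt.inv hm).mul hadj.differentiableAt

/-- If the metric and the volume form are stationary at `s`, then so is the Hodge operator, and
`θ` alone is differentiated in `*θ`. -/
theorem hasFDerivAt_hodge {N p q : ℕ} (h : q + p = N) {G : S → LinearMap.BilinForm ℝ T}
    {W : S → T [⋀^Fin N]→L[ℝ] ℝ} {θ : S → T [⋀^Fin p]→L[ℝ] ℝ}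
    {θ' : S →L[ℝ] T [⋀^Fin p]→L[ℝ] ℝ} {s : S}
    (hg : ∀ x, (∀ y, G s x y = 0) → x = 0)
    (hG : ∀ x y, HasFDerivAt (fun v => G v x y) (0 : S →L[ℝ] ℝ) s)
    (hW : HasFDerivAt W (0 : S →L[ℝ] T [⋀^Fin N]→L[ℝ] ℝ) s) (hθ : HasFDerivAt θ θ' s) :
    HasFDerivAt (fun v => hodge (G v) (W v) h (θ v)) (hodgeCLM (G s) (W s) h ∘L θ') s := by
  set b := Module.finBasis ℝ T with hb
  have hr : ∀ i, HasFDerivAt (fun v => raised (G v) b i) (0 : S →L[ℝ] T) s := by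
    intro i
    have h1 : HasFDerivAt (fun v k l => G v (b k) (b l))
        (0 : S →L[ℝ] (Fin (Module.finrank ℝ T) → Fin (Module.finrank ℝ T) → ℝ)) s :=
      hasFDerivAt_pi'.2 fun k => hasFDerivAt_pi'.2 fun l => hG _ _
    have h2 : ∀ j, HasFDerivAt
        (fun v => (Matrix.of fun k l => G v (b k) (b l))⁻¹ i j • b j) (0 : S →L[ℝ] T) s := by
      intro j
      have h3 := ((differentiableAt_matrix_inv_apply (gram_det_ne_zero hg b) i
        j).hasFDerivAt.comp s h1).smul_const (b j)
      convert! h3 using 1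
      ext u
      simp
    simpa [raised] using HasFDerivAt.fun_sum (u := Finset.univ) fun j _ => h2 j
  refine hasFDerivAt_of_apply fun x => ?_
  simp only [hodge_apply, ← hb]
  have hc : ∀ I : Fin p → Fin (Module.finrank ℝ T),
      HasFDerivAt (fun v => W v (concat h (fun k => raised (G v) b (I k)) x))
        (0 : S →L[ℝ] ℝ) s := by
    intro I
    have h1 : ∀ i, HasFDerivAt (fun v => concat h (fun k => raised (G v) b (I k)) x i)
        (0 : S →L[ℝ] T) s := by
      intro i
      simp only [concat]
      split_ifs
      · exact hr _
      · exact hasFDerivAt_const _ _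
    have h2 := hW.continuousAlternatingMap_apply h1
    convert! h2 using 1
    ext u
    simp
  have h3 := (HasFDerivAt.fun_sum (u := Finset.univ) fun I _ =>
    (hθ.continuousAlternatingMap_apply_const fun k => b (I k)).mul (hc I)).const_mul
      ((p.factorial : ℝ)⁻¹)
  convert! h3 using 1
  ext u
  simp [hodgeCLM_apply, hodge_apply, ← hb, mul_comm]

end Calculus

/-! ### The chart around a point -/

section Param

open Filter Topology

/-- A factor that equals `1` at `0` does not affect the derivative at `0` of a function that
vanishes there. -/
theorem hasFDerivAt_add_smul_linear {S F : Type*} [NormedAddCommGroup S] [NormedSpace ℝ S]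
    [NormedAddCommGroup F] [NormedSpace ℝ F] {c : S → ℝ} (hc : DifferentiableAt ℝ c 0)
    (h0 : c 0 = 1) (y : F) (K : S →L[ℝ] F) : HasFDerivAt (fun v => y + c v • K v) K 0 := by
  convert! (hc.hasFDerivAt.smul K.hasFDerivAt).const_add y using 1
  ext u
  simp [h0]

theorem hasFDerivAt_add_smul_clm {S F : Type*} [NormedAddCommGroup S] [NormedSpace ℝ S]
    [NormedAddCommGroup F] [NormedSpace ℝ F] {c : S → ℝ} (hc : DifferentiableAt ℝ c 0)
    (h0 : c 0 = 1) (L : S →L[ℝ] F) (K : S →L[ℝ] S →L[ℝ] F) :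
    HasFDerivAt (fun v => L + c v • K v) K 0 :=
  hasFDerivAt_add_smul_linear hc h0 L K

variable {n : ℕ} {ε H : ℝ}

theorem param_zero (p : Sig n ε H) : param p 0 = p := by
  simp [param]

theorem sign_sq (hε : ε = 1 ∨ ε = -1) : ε * ε = 1 := by
  rcases hε with rfl | rfl <;> norm_num

theorem sign_ne_zero (hε : ε = 1 ∨ ε = -1) : ε ≠ 0 := by
  rcases hε with rfl | rfl <;> norm_num

theorem param_mem (hε : ε = 1 ∨ ε = -1) (hH : 0 < H) (p : Sig n ε H) {v : Tan n ε (p : E n)}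
    (hv : 0 ≤ 1 + ε * H ^ 2 * eta n ε v v) : param p v ∈ Sig n ε H := by
  have hH' := hH.ne'
  have h1 := Real.mul_self_sqrt hv
  have h2 := sign_sq hε
  simp only [Sig, Set.mem_ofPred_eq, param, map_add, map_smul, LinearMap.add_apply,
    LinearMap.smul_apply, smul_eq_mul, eta_symm (v : E n) p, eta_coe, eta_self]
  have h3 : eta n ε v v + √(1 + ε * H ^ 2 * eta n ε v v) * (√(1 + ε * H ^ 2 * eta n ε v v) *
      (-ε * (H ^ 2)⁻¹)) = eta n ε v v + (1 + ε * H ^ 2 * eta n ε v v) * (-ε * (H ^ 2)⁻¹) := by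
    rw [← mul_assoc, h1]
  calc _ = eta n ε v v + √(1 + ε * H ^ 2 * eta n ε v v) * (√(1 + ε * H ^ 2 * eta n ε v v) *
      (-ε * (H ^ 2)⁻¹)) := by ring
    _ = _ := by
      rw [h3]
      field_simp
      linear_combination (-(eta n ε v v) * H ^ 2) * h2

/-- The second derivative of `param p` at `0`, `(v, u) ↦ ε H² η(v, u) p`. -/
def paramHess (p : Sig n ε H) : Tan n ε (p : E n) →L[ℝ] Tan n ε (p : E n) →L[ℝ] E n :=
  LinearMap.toContinuousBilinearMap (LinearMap.mk₂ ℝ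
    (fun v u : Tan n ε (p : E n) => (ε * H ^ 2 * eta n ε v u) • (p : E n))
    (fun v v' u => by simp [mul_add, add_smul])
    (fun r v u => by simp [smul_smul]; ring_nf)
    (fun v u u' => by simp [mul_add, add_smul])
    (fun r v u => by simp [smul_smul]; ring_nf))

theorem paramHess_apply (p : Sig n ε H) (v u : Tan n ε (p : E n)) :
    paramHess p v u = (ε * H ^ 2 * eta n ε v u) • (p : E n) := rfl

/-- The derivative of the function under the square root in `param p`. -/
theorem hasFDerivAt_radicand (p : Sig n ε H) (v : Tan n ε (p : E n)) :
    HasFDerivAt (fun v : Tan n ε (p : E n) => 1 + ε * H ^ 2 * eta n ε v v)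
      ((2 * (ε * H ^ 2)) • (metricS n ε p).toContinuousBilinearMap v) v := by
  have h1 := (((metricS n ε p).toContinuousBilinearMap.hasFDerivAt_of_bilinear
    (hasFDerivAt_id v) (hasFDerivAt_id v)).const_mul (ε * H ^ 2)).const_add 1
  convert! h1 using 1
  ext u
  simp [metricS_apply, eta_symm (u : E n) v]
  ring

theorem eventually_radicand_pos (p : Sig n ε H) :
    ∀ᶠ v : Tan n ε (p : E n) in 𝓝 0, 0 < 1 + ε * H ^ 2 * eta n ε v v := by
  refine (hasFDerivAt_radicand p 0).continuousAt.eventually (lt_mem_nhds ?_)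
  simp

theorem hasFDerivAt_param (p : Sig n ε H) {v : Tan n ε (p : E n)}
    (hv : 0 < 1 + ε * H ^ 2 * eta n ε v v) :
    HasFDerivAt (param p) ((Tan n ε (p : E n)).subtypeL +
      (√(1 + ε * H ^ 2 * eta n ε v v))⁻¹ • paramHess p v) v := by
  have h1 := (Tan n ε (p : E n)).subtypeL.hasFDerivAt (x := v) |>.add
    (((hasFDerivAt_radicand p v).sqrt hv.ne').smul_const (p : E n))
  convert! h1 using 1
  ext1 u
  simp [paramHess_apply, smul_smul, metricS_apply]
  congr 1
  field_simp

theorem hasFDerivAt_param_zero (p : Sig n ε H) :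
    HasFDerivAt (param p) (Tan n ε (p : E n)).subtypeL 0 := by
  simpa using hasFDerivAt_param p (v := 0) (by simp)

theorem fderiv_param_zero (p : Sig n ε H) :
    fderiv ℝ (param p) 0 = (Tan n ε (p : E n)).subtypeL :=
  (hasFDerivAt_param_zero p).fderiv

theorem contDiffAt_param (p : Sig n ε H) : ContDiffAt ℝ ∞ (param p) 0 := by
  have h1 : ContDiff ℝ ∞ fun v : Tan n ε (p : E n) => 1 + ε * H ^ 2 * eta n ε v v := by
    have : ContDiff ℝ ∞ fun v : Tan n ε (p : E n) =>
        (metricS n ε p).toContinuousBilinearMap v v :=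
      (metricS n ε p).toContinuousBilinearMap.contDiff.clm_apply contDiff_id
    exact contDiff_const.add (contDiff_const.mul this)
  exact (Tan n ε (p : E n)).subtypeL.contDiff.contDiffAt.add
    ((h1.contDiffAt.sqrt (by simp)).smul contDiffAt_const)

theorem hasFDerivAt_fderiv_param (p : Sig n ε H) :
    HasFDerivAt (fderiv ℝ (param p)) (paramHess p) 0 := by
  have h1 : HasFDerivAt (fun v : Tan n ε (p : E n) => (Tan n ε (p : E n)).subtypeL +
      (√(1 + ε * H ^ 2 * eta n ε v v))⁻¹ • paramHess p v) (paramHess p) 0 := by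
    have hc : DifferentiableAt ℝ
        (fun v : Tan n ε (p : E n) => (√(1 + ε * H ^ 2 * eta n ε v v))⁻¹) 0 :=
      ((hasFDerivAt_radicand p 0).sqrt (by simp)).differentiableAt.fun_inv (by simp)
    have h0 : (fun v : Tan n ε (p : E n) => (√(1 + ε * H ^ 2 * eta n ε v v))⁻¹) 0 = 1 := by
      simp
    exact hasFDerivAt_add_smul_clm hc h0 _ (paramHess p)
  refine h1.congr_of_eventuallyEq ?_
  filter_upwards [eventually_radicand_pos p] with v hv
  exact (hasFDerivAt_param p hv).fderiv

theorem fderiv_param_mem_Tan (hε : ε = 1 ∨ ε = -1) (hH : 0 < H) (p : Sig n ε H)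
    {v : Tan n ε (p : E n)} (hv : 0 < 1 + ε * H ^ 2 * eta n ε v v) (u : Tan n ε (p : E n)) :
    fderiv ℝ (param p) v u ∈ Tan n ε (param p v) := by
  have hH' := hH.ne'
  have h2 := sign_sq hε
  have h3 := (Real.sqrt_pos.2 hv).ne'
  rw [mem_Tan, (hasFDerivAt_param p hv).fderiv]
  simp only [param, add_apply, smul_apply,
    paramHess_apply, Submodule.subtypeL_apply, map_add, map_smul, LinearMap.add_apply,
    LinearMap.smul_apply, smul_eq_mul, eta_symm (v : E n) p, eta_coe, eta_self]
  field_simp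
  linear_combination (-(√(1 + ε * H ^ 2 * eta n ε v v) * eta n ε v u)) * h2

theorem fderiv_param_injective (hε : ε = 1 ∨ ε = -1) (hH : 0 < H) (p : Sig n ε H)
    {v : Tan n ε (p : E n)} (hv : 0 < 1 + ε * H ^ 2 * eta n ε v v) {u : Tan n ε (p : E n)}
    (hu : fderiv ℝ (param p) v u = 0) : u = 0 := by
  have hp := eta_self_ne_zero (sign_ne_zero hε) hH p
  rw [(hasFDerivAt_param p hv).fderiv] at hu
  simp only [add_apply, smul_apply, paramHess_apply,
    Submodule.subtypeL_apply, smul_smul] at hu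
  have h1 := congrArg (eta n ε p) hu
  simp only [map_add, map_smul, eta_coe, smul_eq_mul, map_zero, zero_add] at h1
  rw [(mul_eq_zero.1 h1).resolve_right hp] at hu
  ext1
  simpa using hu

end Param

/-! ### Metric, volume form and Hodge operator in the chart -/

section Pull

open Filter Topology

variable {n : ℕ} {ε H : ℝ}

theorem pullS_restr_eventuallyEq (hε : ε = 1 ∨ ε = -1) (hH : 0 < H) (p : Sig n ε H) {a : ℕ}
    (α : Form n a) : pullS (param p) (restr ε H α) =ᶠ[𝓝 0]
      fun v => (α (param p v)).compContinuousLinearMap (fderiv ℝ (param p) v) := by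
  filter_upwards [eventually_radicand_pos p] with v hv
  rw [pullS, dif_pos ⟨param_mem hε hH p hv.le, fderiv_param_mem_Tan hε hH p hv⟩]
  rfl

/-- The metric of the (anti-)de Sitter space in the chart `param p`. -/
def chartMetric (p : Sig n ε H) (v : Tan n ε (p : E n)) :
    LinearMap.BilinForm ℝ (Tan n ε (p : E n)) :=
  (eta n ε).compl₁₂ (fderiv ℝ (param p) v : Tan n ε (p : E n) →ₗ[ℝ] E n)
    (fderiv ℝ (param p) v : Tan n ε (p : E n) →ₗ[ℝ] E n)

/-- The volume form of the (anti-)de Sitter space in the chart `param p`. -/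
def chartVol (p : Sig n ε H) (v : Tan n ε (p : E n)) : Tan n ε (p : E n) [⋀^Fin n]→L[ℝ] ℝ :=
  (-1 : ℝ) ^ n •
    ((vol n).curryLeft (eN n ε (param p v))).compContinuousLinearMap (fderiv ℝ (param p) v)

theorem chartMetric_apply (p : Sig n ε H) (v x y : Tan n ε (p : E n)) :
    chartMetric p v x y = eta n ε (fderiv ℝ (param p) v x) (fderiv ℝ (param p) v y) := rfl

theorem chartMetric_zero (p : Sig n ε H) : chartMetric p 0 = metricS n ε p := by
  ext x y
  rw [chartMetric_apply, fderiv_param_zero, metricS_apply]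
  rfl

theorem chartVol_zero (p : Sig n ε H) : chartVol p 0 = volS n ε p := by
  rw [chartVol, fderiv_param_zero, param_zero, volS]

/-- In the chart `param p`, the Hodge operator of the (anti-)de Sitter space is the one of the
metric and the volume form in this chart. -/
theorem pullS_hodgeS_eventuallyEq (hε : ε = 1 ∨ ε = -1) (hH : 0 < H) (p : Sig n ε H) {a q : ℕ}
    (h : q + a = n) (α : Form n a) :
    pullS (param p) (hodgeS h (restr ε H α)) =ᶠ[𝓝 0]
      fun v => hodge (chartMetric p v) (chartVol p v) h
        ((α (param p v)).compContinuousLinearMap (fderiv ℝ (param p) v)) := by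
  filter_upwards [eventually_radicand_pos p] with v hv
  have hmem := param_mem hε hH p hv.le
  have htan := fderiv_param_mem_Tan hε hH p hv
  have hε0 := sign_ne_zero hε
  have hp := eta_self_ne_zero hε0 hH p
  have hp' := eta_self_ne_zero hε0 hH ⟨_, hmem⟩
  rw [pullS, dif_pos ⟨hmem, htan⟩]
  let f := (fderiv ℝ (param p) v).codRestrict (Tan n ε (param p v)) htan
  have hf : Function.Injective f := by
    refine (injective_iff_map_eq_zero f).2 fun u hu => ?_
    exact fderiv_param_injective hε hH p hv (congrArg Subtype.val hu)
  let e : Tan n ε (p : E n) ≃L[ℝ] Tan n ε (param p v) :=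
    (LinearMap.linearEquivOfInjective (f : Tan n ε (p : E n) →ₗ[ℝ] Tan n ε (param p v)) hf
      ((finrank_Tan hp).trans (finrank_Tan hp').symm)).toContinuousLinearEquiv
  have he : (e : Tan n ε (p : E n) →L[ℝ] Tan n ε (param p v)) = f := by
    ext1 u
    rfl
  have := hodge_comp_equiv (g := chartMetric p v) (g' := metricS n ε (param p v)) e
    (fun x y => rfl) metricS_symm (metricS_nondegenerate hε0 hp') (volS n ε (param p v)) h
    (restr ε H α ⟨_, hmem⟩)
  rw [he] at this
  exact this

/-- The chart metric is stationary at `0`, because the second derivative of `param p` at `0` is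
normal to the tangent space. -/
theorem hasFDerivAt_chartMetric (p : Sig n ε H) (x y : Tan n ε (p : E n)) :
    HasFDerivAt (fun v => chartMetric p v x y) (0 : Tan n ε (p : E n) →L[ℝ] ℝ) 0 := by
  have hx : ∀ x, HasFDerivAt (fun v => fderiv ℝ (param p) v x) ((paramHess p).flip x) 0 :=
    fun x => by
      simpa using (hasFDerivAt_fderiv_param p).clm_apply (hasFDerivAt_const x 0)
  have h1 := (eta n ε).toContinuousBilinearMap.hasFDerivAt_of_bilinear (hx x) (hx y)
  convert! h1 using 1
  ext u
  simp [fderiv_param_zero, paramHess_apply, eta_symm (x : E n) p]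

theorem vol_eq_zero_of_Tan {p : E n} (hp : eta n ε p p ≠ 0) (x : Fin (n + 1) → E n)
    (hx : ∀ i, x i ∈ Tan n ε p) : vol n x = 0 := by
  have h1 := alternating_eq_zero_of_finrank_lt (m := n + 1) (by rw [finrank_Tan hp]; omega)
    ((vol n).compContinuousLinearMap (Tan n ε p).subtypeL)
  exact DFunLike.congr_fun h1 fun i => ⟨x i, hx i⟩

/-- The chart volume form is stationary at `0`: differentiating the normal leaves `n + 1` vectors
in the `n`-dimensional tangent space, and differentiating a tangent vector makes it a multiple of
the normal, which is already an argument. -/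
theorem hasFDerivAt_chartVol (hε : ε = 1 ∨ ε = -1) (hH : 0 < H) (p : Sig n ε H) :
    HasFDerivAt (chartVol p) (0 : Tan n ε (p : E n) →L[ℝ] Tan n ε (p : E n) [⋀^Fin n]→L[ℝ] ℝ)
      0 := by
  have hp := eta_self_ne_zero (sign_ne_zero hε) hH p
  refine hasFDerivAt_of_apply fun x => ?_
  let c' : Fin (n + 1) → Tan n ε (p : E n) →L[ℝ] E n :=
    Fin.cons (H • (Tan n ε (p : E n)).subtypeL) fun k => (paramHess p).flip (x k)
  have h1 : ∀ i, HasFDerivAt (fun v => Matrix.vecCons (eN n ε (param p v))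
      (fun k => fderiv ℝ (param p) v (x k)) i) (c' i) 0 := by
    intro i
    refine Fin.cases ?_ (fun k => ?_) i
    · simp only [Matrix.cons_val_zero]
      refine ((hasFDerivAt_param_zero p).const_smul H).congr_of_eventuallyEq ?_
      filter_upwards [eventually_radicand_pos p] with v hv
      exact eN_eq hε hH ⟨_, param_mem hε hH p hv.le⟩
    · simp only [Matrix.cons_val_succ]
      simpa [c'] using (hasFDerivAt_fderiv_param p).clm_apply (hasFDerivAt_const (x k) 0)
  have h2 := ((hasFDerivAt_const (vol n) (0 : Tan n ε (p : E n))).continuousAlternatingMap_apply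
    h1).const_mul ((-1 : ℝ) ^ n)
  convert! h2 using 1
  ext1 u
  simp only [ContinuousLinearMap.comp_zero, smul_apply, zero_add,
    zero_apply, sum_apply, ContinuousLinearMap.comp_apply]
  symm
  refine smul_eq_zero_of_right _ (Finset.sum_eq_zero fun i _ => ?_)
  rw [param_zero, fderiv_param_zero, eN_eq hε hH]
  change vol n (Function.update _ i (c' i u)) = 0
  refine Fin.cases ?_ (fun k => ?_) i
  · refine vol_eq_zero_of_Tan hp _ fun j => ?_
    refine Fin.cases ?_ (fun j => ?_) j
    · simp [c']
    · simp
  · have : c' k.succ u = (ε * H * eta n ε u (x k)) • (H • (p : E n)) := by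
      simp [c', paramHess_apply, smul_smul]
      ring_nf
    rw [this, (vol n).map_update_smul]
    refine smul_eq_zero_of_right _ ((vol n).map_eq_zero_of_eq _ (i := 0) (j := k.succ) ?_
      (Fin.succ_ne_zero k).symm)
    simp [Function.update_of_ne (Fin.succ_ne_zero k).symm]

end Pull

/-! ### The codifferential in the chart -/

section CompDeriv

variable {S F : Type*} [NormedAddCommGroup S] [NormedSpace ℝ S] [NormedAddCommGroup F]
  [NormedSpace ℝ F] {a : ℕ}

/-- The derivative at a point of the pullback `x ↦ (f^*α)_x`, when `A`, `w`, `L`, `K` are the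
derivative and the value of `α` and the first and the second derivative of `f` there. -/
def compDeriv (A : F →L[ℝ] F [⋀^Fin a]→L[ℝ] ℝ) (w : F [⋀^Fin a]→L[ℝ] ℝ) (L : S →L[ℝ] F)
    (K : S →L[ℝ] S →L[ℝ] F) : S →L[ℝ] S [⋀^Fin a]→L[ℝ] ℝ :=
  ContinuousAlternatingMap.compContinuousLinearMapCLM L ∘L (A ∘L L) +
    w.fderivCompContinuousLinearMap L ∘L K

theorem compDeriv_apply (A : F →L[ℝ] F [⋀^Fin a]→L[ℝ] ℝ) (w : F [⋀^Fin a]→L[ℝ] ℝ) (L : S →L[ℝ] F)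
    (K : S →L[ℝ] S →L[ℝ] F) (u : S) (x : Fin a → S) :
    compDeriv A w L K u x = A (L u) (fun j => L (x j)) +
      ∑ l, w (Function.update (fun j => L (x j)) l (K u (x l))) := by
  have h : ∀ l, (fun j => Function.update (fun _ => L) l (K u) j (x j)) =
      Function.update (fun j => L (x j)) l (K u (x l)) := by
    intro l
    ext1 j
    by_cases hj : j = l
    · subst hj
      simp
    · rw [Function.update_of_ne hj, Function.update_of_ne hj]
  simp only [compDeriv, add_apply, ContinuousAlternatingMap.add_apply,
    ContinuousLinearMap.comp_apply, ContinuousAlternatingMap.compContinuousLinearMapCLM_apply,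
    ContinuousAlternatingMap.compContinuousLinearMap_apply,
    ContinuousAlternatingMap.fderivCompContinuousLinearMap_apply, h]
  rfl

theorem hasFDerivAt_compDeriv {α : F → F [⋀^Fin a]→L[ℝ] ℝ} {f : S → F} {x : S}
    {K : S →L[ℝ] S →L[ℝ] F} (hα : DifferentiableAt ℝ α (f x)) (hf : DifferentiableAt ℝ f x)
    (hK : HasFDerivAt (fderiv ℝ f) K x) :
    HasFDerivAt (fun y => (α (f y)).compContinuousLinearMap (fderiv ℝ f y))
      (compDeriv (fderiv ℝ α (f x)) (α (f x)) (fderiv ℝ f x) K) x :=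
  (hα.hasFDerivAt.comp x hf.hasFDerivAt).continuousAlternatingMapCompContinuousLinearMap hK

end CompDeriv

section Codiff

open Filter Topology

variable {n : ℕ} {ε H : ℝ}

/-- The derivative at `p` of the pullback of `α` by `param p`. -/
def pullDeriv (p : Sig n ε H) {a : ℕ} (α : Form n a) :
    Tan n ε (p : E n) →L[ℝ] Tan n ε (p : E n) [⋀^Fin a]→L[ℝ] ℝ :=
  compDeriv (fderiv ℝ α p) (α p) (Tan n ε (p : E n)).subtypeL (paramHess p)

theorem hasFDerivAt_pull (p : Sig n ε H) {a : ℕ} {α : Form n a}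
    (hα : DifferentiableAt ℝ α p) :
    HasFDerivAt (fun v => (α (param p v)).compContinuousLinearMap (fderiv ℝ (param p) v))
      (pullDeriv p α) 0 := by
  have h2 := hasFDerivAt_compDeriv (α := α) (f := param p) (x := 0) (by rwa [param_zero])
    (hasFDerivAt_param_zero p).differentiableAt (hasFDerivAt_fderiv_param p)
  rw [fderiv_param_zero, param_zero] at h2
  exact h2

/-- Metric and volume form are stationary at the origin of the chart `param p`, so the formula
`δ = -tr ∇` of flat space holds there. -/
theorem codiffSuccS_restr (hε : ε = 1 ∨ ε = -1) (hH : 0 < H) (p : Sig n ε H) {a : ℕ}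
    {α : Form n (a + 1)} (hα : DifferentiableAt ℝ α p) :
    codiffSuccS (restr ε H α) p = -traceForm (metricS n ε p) (pullDeriv p α) := by
  have hp := eta_self_ne_zero (sign_ne_zero hε) hH p
  unfold codiffSuccS
  split_ifs with h
  · have h1 := (hasFDerivAt_hodge (Nat.sub_add_cancel h) (G := chartMetric p) (W := chartVol p)
      (by rw [chartMetric_zero]; exact metricS_nondegenerate (sign_ne_zero hε) hp)
      (hasFDerivAt_chartMetric p) (hasFDerivAt_chartVol hε hH p)
      (hasFDerivAt_pull p hα)).congr_of_eventuallyEq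
        (pullS_hodgeS_eventuallyEq hε hH p (Nat.sub_add_cancel h) α)
    rw [chartMetric_zero, chartVol_zero] at h1
    unfold dS extDeriv
    beta_reduce
    rw [h1.fderiv]
    exact hodgeInv_alternatize_hodge metricS_symm
      (metricS_nondegenerate (sign_ne_zero hε) hp) (finrank_Tan hp) (volS_ne_zero hε hH p) _ _
  · rw [traceForm_eq_zero (finrank_Tan hp) (by omega)]
    simp

/-- Exchanging `x` with the entry `w k` in the argument `(x, w)` of an alternating map. -/
theorem vecCons_update_swap {F : Type*} [NormedAddCommGroup F] [NormedSpace ℝ F] {a : ℕ}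
    (f : F [⋀^Fin (a + 1)]→L[ℝ] ℝ) (x : F) (w : Fin a → F) (k : Fin a) :
    f (Matrix.vecCons (w k) (Function.update w k x)) = -f (Matrix.vecCons x w) := by
  have h1 := f.toAlternatingMap.map_swap (Matrix.vecCons x w) (Fin.succ_ne_zero k).symm
  have h2 : Matrix.vecCons x w ∘ Equiv.swap 0 k.succ =
      Matrix.vecCons (w k) (Function.update w k x) := by
    ext i
    refine Fin.cases ?_ (fun i => ?_) i
    · simp
    · by_cases hi : i = k
      · subst hi
        simp
      · rw [Function.comp_apply, Equiv.swap_apply_of_ne_of_ne (Fin.succ_ne_zero i)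
          (fun h => hi (Fin.succ_injective _ h))]
        simp [hi]
  rw [h2] at h1
  exact h1

/-- The tangential trace. The second derivative of `param p` contributes the `p`-component of `α`
once for each of the `n` tangent directions, and `-1` times it for each of the `a` arguments in `w`,
whence the factor `n - a`. -/
theorem traceForm_pullDeriv (hε : ε = 1 ∨ ε = -1) (hH : 0 < H) (p : Sig n ε H) {a : ℕ}
    (α : Form n (a + 1)) (w : Fin a → Tan n ε (p : E n)) :
    traceForm (metricS n ε p) (pullDeriv p α) w =
      ∑ i, fderiv ℝ α p
        (raised (metricS n ε p) (Module.finBasis ℝ (Tan n ε (p : E n))) i : Tan n ε (p : E n))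
        (Matrix.vecCons (Module.finBasis ℝ (Tan n ε (p : E n)) i : E n) (fun j => (w j : E n))) +
      ε * H ^ 2 * (n - a) * α p (Matrix.vecCons (p : E n) (fun j => (w j : E n))) := by
  have hp := eta_self_ne_zero (sign_ne_zero hε) hH p
  have hnd := metricS_nondegenerate (sign_ne_zero hε) hp
  set b := Module.finBasis ℝ (Tan n ε (p : E n)) with hb
  set r := raised (metricS n ε p) b with hr
  have hfin : Module.finrank ℝ (Tan n ε (p : E n)) = n := finrank_Tan hp
  have hterm : ∀ i, pullDeriv p α (r i) (Matrix.vecCons (b i) w) =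
      fderiv ℝ α p (r i) (Matrix.vecCons (b i : E n) (fun j => (w j : E n))) +
      (ε * H ^ 2 * α p (Matrix.vecCons (p : E n) (fun j => (w j : E n))) +
      ∑ k, ε * H ^ 2 * (eta n ε (r i) (w k) * α p (Matrix.vecCons (b i : E n)
        (Function.update (fun j => (w j : E n)) k p)))) := by
    intro i
    have e0 : (fun j => ((Matrix.vecCons (b i) w j : Tan n ε (p : E n)) : E n)) =
        Matrix.vecCons (b i : E n) (fun j => (w j : E n)) := by
      ext1 j
      refine Fin.cases ?_ (fun j => ?_) j <;> simp
    rw [pullDeriv, compDeriv_apply, Fin.sum_univ_succ]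
    simp only [paramHess_apply, Submodule.subtypeL_apply, e0,
      ContinuousAlternatingMap.map_update_smul]
    congr 2
    · have h1 : eta n ε (r i) (b i) = 1 := by
        have := raised_left hnd b i i
        rwa [if_pos rfl] at this
      simp only [Matrix.cons_val_zero, h1, mul_one, smul_eq_mul]
      congr 2
      ext1 j
      refine Fin.cases ?_ (fun j => ?_) j <;> simp
    · refine Finset.sum_congr rfl fun k _ => ?_
      simp only [Matrix.cons_val_succ, smul_eq_mul, mul_assoc]
      congr 4
      ext1 j
      refine Fin.cases ?_ (fun j => ?_) j
      · exact Function.update_of_ne (Fin.succ_ne_zero k).symm _ _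
      · by_cases hj : j = k
        · subst hj
          simp
        · simp [hj]
  have hsum : ∀ k, ∑ i, eta n ε (r i) (w k) * α p (Matrix.vecCons (b i : E n)
        (Function.update (fun j => (w j : E n)) k p)) =
      -α p (Matrix.vecCons (p : E n) (fun j => (w j : E n))) := by
    intro k
    have h1 := congrArg (fun z : Tan n ε (p : E n) => (α p).curryLeft (z : E n)
      (Function.update (fun j => (w j : E n)) k p)) (sum_raised_smul hnd b (w k))
    simp only [Submodule.coe_sum, Submodule.coe_smul, map_sum, map_smul,
      ContinuousAlternatingMap.sum_apply, ContinuousAlternatingMap.smul_apply,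
      ContinuousAlternatingMap.curryLeft_apply_apply, smul_eq_mul] at h1
    rw [← vecCons_update_swap (α p) (p : E n) (fun j => (w j : E n)) k]
    exact h1
  rw [traceForm, ContinuousAlternatingMap.sum_apply]
  simp only [ContinuousAlternatingMap.curryLeft_apply_apply, ← hb, ← hr, hterm]
  rw [Finset.sum_add_distrib, Finset.sum_add_distrib, Finset.sum_comm]
  simp only [← Finset.mul_sum, hsum]
  simp only [Finset.sum_const, Finset.card_univ, Fintype.card_fin, nsmul_eq_mul, hfin]
  ring

/-- The two codifferentials compared at a point `p`: what is left is the normal part of the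
ambient trace and the contribution of the second derivative of `param p`. -/
theorem restr_codiffSucc (hε : ε = 1 ∨ ε = -1) (hH : 0 < H) (p : Sig n ε H) {a : ℕ}
    {α : Form n (a + 1)} (hα : DifferentiableAt ℝ α p) (w : Fin a → Tan n ε (p : E n)) :
    restr ε H (codiffSucc n ε α) p w = codiffSuccS (restr ε H α) p w +
      ε * H ^ 2 * (fderiv ℝ α p p (Matrix.vecCons (p : E n) (fun j => (w j : E n))) +
        (n - a) * α p (Matrix.vecCons (p : E n) (fun j => (w j : E n)))) := by
  have hp := eta_self_ne_zero (sign_ne_zero hε) hH p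
  have hH' := hH.ne'
  let B : E n →ₗ[ℝ] E n →ₗ[ℝ] ℝ := LinearMap.mk₂ ℝ
    (fun x y => fderiv ℝ α p x (Matrix.vecCons y (fun j => (w j : E n))))
    (fun x x' y => by simp) (fun r x y => by simp)
    (fun x y y' => by
      exact congrArg (fun f => f fun j => (w j : E n))
        ((fderiv ℝ α p x).curryLeft.map_add y y'))
    (fun r x y => by
      exact congrArg (fun f => f fun j => (w j : E n))
        ((fderiv ℝ α p x).curryLeft.map_smul r y))
  have h1 := sum_raised_eta (sign_ne_zero hε) hp (Module.finBasis ℝ (E n))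
    (Module.finBasis ℝ (Tan n ε (p : E n))) B
  have hB : ∀ x y, B x y = fderiv ℝ α p x (Matrix.vecCons y (fun j => (w j : E n))) :=
    fun _ _ => rfl
  simp only [hB] at h1
  rw [codiffSuccS_restr hε hH p hα, ContinuousAlternatingMap.neg_apply,
    traceForm_pullDeriv hε hH p α w, restr, codiffSucc_eq (sign_ne_zero hε) hα, traceForm]
  simp only [ContinuousAlternatingMap.compContinuousLinearMap_apply,
    ContinuousAlternatingMap.neg_apply, ContinuousAlternatingMap.sum_apply,
    ContinuousAlternatingMap.curryLeft_apply_apply]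
  have h2 : (eta n ε (p : E n) p)⁻¹ = -ε * H ^ 2 := by
    rw [eta_self]
    rcases hε with rfl | rfl <;> field_simp
  rw [h2] at h1
  refine (congrArg Neg.neg h1).trans ?_
  rw [smul_eq_mul]
  ring

end Codiff

/-! ### The unit normal and the Lie derivative -/

section Normal

open Filter Topology

variable {n : ℕ} {ε H : ℝ}

/-- The derivative of `e_n` at a point `p` of the (anti-)de Sitter space. -/
def eNDeriv (p : Sig n ε H) : E n →L[ℝ] E n :=
  H • ContinuousLinearMap.id ℝ (E n) +
    ((ε * H ^ 3) • LinearMap.toContinuousLinearMap (eta n ε p)).smulRight (p : E n)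

theorem hasFDerivAt_eta_self (y : E n) :
    HasFDerivAt (fun y => eta n ε y y)
      ((2 : ℝ) • LinearMap.toContinuousLinearMap (eta n ε y)) y := by
  have h1 := (eta n ε).toContinuousBilinearMap.hasFDerivAt_of_bilinear
    (hasFDerivAt_id y) (hasFDerivAt_id y)
  convert! h1 using 1
  ext1 u
  simp [eta_symm u y, two_mul]

theorem hasFDerivAt_eN (hε : ε = 1 ∨ ε = -1) (hH : 0 < H) (p : Sig n ε H) :
    HasFDerivAt (eN n ε) (eNDeriv p) p := by
  have hH' := hH.ne'
  have hq : -ε * eta n ε (p : E n) p = (H⁻¹) ^ 2 := by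
    rw [eta_self]
    rcases hε with rfl | rfl <;> simp
  have h1 := ((hasFDerivAt_eta_self (ε := ε) (p : E n)).const_mul (-ε)).sqrt
    (by rw [hq]; positivity)
  have h2 := (hasDerivAt_inv (x := √(-ε * eta n ε (p : E n) p))
    (by rw [hq, Real.sqrt_sq (by positivity)]; positivity)).comp_hasFDerivAt (p : E n) h1
  have h3 : HasFDerivAt (hfun n ε)
      ((ε * H ^ 3) • LinearMap.toContinuousLinearMap (eta n ε p)) p := by
    have hev : hfun n ε =ᶠ[𝓝 (p : E n)] Inv.inv ∘ fun y => √(-ε * eta n ε y y) := by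
      have : ∀ᶠ y in 𝓝 (p : E n), 0 < -ε * eta n ε y y := by
        refine ((hasFDerivAt_eta_self (ε := ε) (p : E n)).const_mul
          (-ε)).continuousAt.eventually (lt_mem_nhds ?_)
        change 0 < -ε * eta n ε (p : E n) p
        rw [hq]
        positivity
      filter_upwards [this] with y hy
      rw [hfun, Function.comp_apply, ← abs_of_pos hy, abs_mul, abs_neg]
      have : |ε| = 1 := by rcases hε with rfl | rfl <;> simp
      rw [this, one_mul]
    refine HasFDerivAt.congr_of_eventuallyEq ?_ hev
    convert! h2 using 1
    ext1 u
    simp only [hq, Real.sqrt_sq (inv_nonneg.2 hH.le), smul_apply, smul_eq_mul]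
    field_simp
  have h4 := h3.smul (hasFDerivAt_id (p : E n))
  have h5 : hfun n ε p = H := by
    have := eN_eq hε hH p
    have hne : (p : E n) ≠ 0 := by
      intro h0
      have := eta_self_ne_zero (sign_ne_zero hε) hH p
      simp [h0] at this
    exact smul_left_injective ℝ hne this
  convert! h4 using 1
  rw [h5]
  rfl

/-- The shape operator of the (anti-)de Sitter space is `H` times the identity. -/
theorem eNDeriv_tangent (p : Sig n ε H) (u : Tan n ε (p : E n)) :
    eNDeriv p u = H • (u : E n) := by
  simp [eNDeriv]

/-- The field `e_n` is homogeneous of degree `0`. -/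
theorem eNDeriv_self (hε : ε = 1 ∨ ε = -1) (hH : 0 < H) (p : Sig n ε H) : eNDeriv p p = 0 := by
  have hH' := hH.ne'
  have : H + ε * H ^ 3 * (-ε * (H ^ 2)⁻¹) = 0 := by
    field_simp
    linear_combination (-H ^ 1) * sign_sq hε
  simp only [eNDeriv, add_apply, smul_apply, ContinuousLinearMap.id_apply,
    ContinuousLinearMap.smulRight_apply, LinearMap.coe_toContinuousLinearMap', eta_self,
    smul_eq_mul]
  rw [← add_smul, this, zero_smul]

/-- `ContinuousAlternatingMap.curryLeft` as a continuous linear map. -/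
def curryLeftCLM {F : Type*} [NormedAddCommGroup F] [NormedSpace ℝ F] {a : ℕ} :
    (F [⋀^Fin (a + 1)]→L[ℝ] ℝ) →L[ℝ] F →L[ℝ] F [⋀^Fin a]→L[ℝ] ℝ :=
  ContinuousAlternatingMap.curryLeftLI.toContinuousLinearMap

theorem hasFDerivAt_curryLeft_apply {F : Type*} [NormedAddCommGroup F] [NormedSpace ℝ F] {a : ℕ}
    {v : F → F} {v' : F →L[ℝ] F} {β : F → F [⋀^Fin (a + 1)]→L[ℝ] ℝ} {y : F}
    (hv : HasFDerivAt v v' y) (hβ : DifferentiableAt ℝ β y) :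
    HasFDerivAt (fun y => (β y).curryLeft (v y)) ((β y).curryLeft ∘L v' +
      (curryLeftCLM ∘L fderiv ℝ β y).flip (v y)) y := by
  have h1 := HasFDerivAt.comp (F := F [⋀^Fin (a + 1)]→L[ℝ] ℝ) (G := F →L[ℝ] F [⋀^Fin a]→L[ℝ] ℝ) y
    (ContinuousLinearMap.hasFDerivAt curryLeftCLM) hβ.hasFDerivAt
  exact h1.clm_apply hv

theorem hasFDerivAt_intProdSucc {a : ℕ} {v : E n → E n} {v' : E n →L[ℝ] E n}
    {β : Form n (a + 1)} {y : E n} (hv : HasFDerivAt v v' y) (hβ : DifferentiableAt ℝ β y) :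
    HasFDerivAt (intProdSucc v β) ((β y).curryLeft ∘L v' +
      (curryLeftCLM ∘L fderiv ℝ β y).flip (v y)) y :=
  hasFDerivAt_curryLeft_apply hv hβ

theorem fderiv_intProdSucc_apply {a : ℕ} {v : E n → E n} {v' : E n →L[ℝ] E n}
    {β : Form n (a + 1)} {y : E n} (hv : HasFDerivAt v v' y) (hβ : DifferentiableAt ℝ β y)
    (u : E n) (x : Fin a → E n) :
    fderiv ℝ (intProdSucc v β) y u x =
      β y (Matrix.vecCons (v' u) x) + fderiv ℝ β y u (Matrix.vecCons (v y) x) := by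
  rw [(hasFDerivAt_intProdSucc hv hβ).fderiv]
  rfl

/-- The term of `i_v dβ` that differentiates along `v`, split off from the others. -/
theorem intProdSucc_extDeriv_apply {a : ℕ} {v : E n → E n} {β : Form n a} {y : E n}
    (x : Fin a → E n) :
    intProdSucc v (extDeriv β) y x = fderiv ℝ β y (v y) x +
      ∑ k : Fin a, (-1 : ℝ) ^ ((k : ℕ) + 1) * fderiv ℝ β y (x k)
        (Fin.removeNth k.succ (Matrix.vecCons (v y) x)) := by
  rw [intProdSucc, ContinuousAlternatingMap.curryLeft_apply_apply, extDeriv,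
    ContinuousAlternatingMap.alternatizeUncurryFin_apply, Fin.sum_univ_succ]
  simp only [zsmul_eq_mul, Int.cast_pow, Int.cast_neg, Int.cast_one, Fin.val_succ,
    Matrix.cons_val_succ, Matrix.cons_val_zero]
  congr 1
  simp only [Fin.val_zero, pow_zero, one_mul]
  congr 1

/-- Moving the `k`-th argument of an alternating map to the front. -/
theorem map_vecCons_removeNth {F : Type*} [NormedAddCommGroup F] [NormedSpace ℝ F] {a : ℕ}
    (f : F [⋀^Fin (a + 1)]→L[ℝ] ℝ) (x : Fin (a + 1) → F) (k : Fin (a + 1)) :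
    (-1 : ℝ) ^ (k : ℕ) * f (Matrix.vecCons (x k) (k.removeNth x)) = f x := by
  rw [← f.neg_one_pow_smul_map_insertNth k, Fin.insertNth_self_removeNth, zsmul_eq_mul,
    ← mul_assoc]
  push_cast
  rw [← mul_pow]
  simp

/-- On tangent vectors, `ℒ_n` is the derivative in the direction of the normal plus `H` for each
argument. -/
theorem lieD_apply (hε : ε = 1 ∨ ε = -1) (hH : 0 < H) (p : Sig n ε H) {a : ℕ}
    {β : Form n a} (hβ : DifferentiableAt ℝ β p) (w : Fin a → Tan n ε (p : E n)) :
    restr ε H (lieD (eN n ε) β) p w = H * fderiv ℝ β p p (fun j => (w j : E n)) +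
      a * H * β p (fun j => (w j : E n)) := by
  set x : Fin a → E n := fun j => (w j : E n) with hx
  have h1 : restr ε H (lieD (eN n ε) β) p w = intProdSucc (eN n ε) (extDeriv β) p x +
      dPred (intProd (eN n ε) β) p x := rfl
  have h0 : fderiv ℝ β p (eN n ε p) x = H * fderiv ℝ β p p x := by
    rw [eN_eq hε hH]
    simp
  rw [h1, intProdSucc_extDeriv_apply, h0]
  cases a with
  | zero =>
    simp [dPred]
  | succ a =>
    have h2 : dPred (intProd (eN n ε) β) p x = ∑ k : Fin (a + 1), (-1 : ℝ) ^ (k : ℕ) *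
        (β p (Matrix.vecCons (eNDeriv p (x k)) (k.removeNth x)) +
          fderiv ℝ β p (x k) (Matrix.vecCons (eN n ε p) (k.removeNth x))) := by
      change extDeriv (intProdSucc (eN n ε) β) p x = _
      rw [extDeriv, ContinuousAlternatingMap.alternatizeUncurryFin_apply]
      refine Finset.sum_congr rfl fun k _ => ?_
      rw [fderiv_intProdSucc_apply (hasFDerivAt_eN hε hH p) hβ, zsmul_eq_mul]
      push_cast
      rfl
    have h3 : ∀ k : Fin (a + 1), Fin.removeNth k.succ (Matrix.vecCons (eN n ε p) x) =
        Matrix.vecCons (eN n ε p) (k.removeNth x) := by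
      intro k
      ext1 j
      refine Fin.cases ?_ (fun j => ?_) j <;> simp [Fin.removeNth]
    have h4 : ∀ k : Fin (a + 1), (-1 : ℝ) ^ (k : ℕ) *
        β p (Matrix.vecCons (eNDeriv p (x k)) (k.removeNth x)) = H * β p x := by
      intro k
      rw [hx, eNDeriv_tangent, ← hx, ContinuousAlternatingMap.vecCons_smul, smul_eq_mul,
        mul_left_comm]
      congr 1
      exact map_vecCons_removeNth (β p) x k
    rw [h2]
    simp only [mul_add, h3, Finset.sum_add_distrib, h4, pow_succ]
    simp
    ring

/-- The formula for the codifferential, in positive degree. -/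
theorem restr_codiffSucc_eq_sub_lieD (hn : 1 ≤ n) (hε : ε = 1 ∨ ε = -1) (hH : 0 < H) {a : ℕ}
    {α : Form n (a + 1)} (hα : ∀ p : Sig n ε H, DifferentiableAt ℝ α p) :
    restr ε H (codiffSucc n ε α) = codiffSuccS (restr ε H α) -
      etaUpNN n ε • restr ε H (lieD (eN n ε) (intProdSucc (eN n ε) α) +
        (H * ((n : ℝ) - 2 * (a + 1 : ℕ) + 2)) • intProdSucc (eN n ε) α) := by
  funext p
  ext w
  have h0 := hasFDerivAt_eN hε hH p
  have h1 : (restr ε H (lieD (eN n ε) (intProdSucc (eN n ε) α) +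
        (H * ((n : ℝ) - 2 * (a + 1 : ℕ) + 2)) • intProdSucc (eN n ε) α)) p w =
      restr ε H (lieD (eN n ε) (intProdSucc (eN n ε) α)) p w +
        (H * ((n : ℝ) - 2 * (a + 1 : ℕ) + 2)) *
          α p (Matrix.vecCons (eN n ε p) (fun j => (w j : E n))) := rfl
  have h2 : α p (Matrix.vecCons (eN n ε p) (fun j => (w j : E n))) =
      H * α p (Matrix.vecCons (p : E n) (fun j => (w j : E n))) := by
    rw [eN_eq hε hH, ContinuousAlternatingMap.vecCons_smul, smul_eq_mul]
  have h3 : fderiv ℝ α p p (Matrix.vecCons (eN n ε p) (fun j => (w j : E n))) =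
      H * fderiv ℝ α p p (Matrix.vecCons (p : E n) (fun j => (w j : E n))) := by
    rw [eN_eq hε hH, ContinuousAlternatingMap.vecCons_smul, smul_eq_mul]
  have h4 : α p (Matrix.vecCons (0 : E n) (fun j => (w j : E n))) = 0 :=
    (α p).map_coord_zero 0 rfl
  have h5 : intProdSucc (eN n ε) α p (fun j => (w j : E n)) =
      α p (Matrix.vecCons (eN n ε p) (fun j => (w j : E n))) := rfl
  rw [restr_codiffSucc hε hH p (hα p)]
  change _ = codiffSuccS (restr ε H α) p w - etaUpNN n ε *
    (restr ε H (lieD (eN n ε) (intProdSucc (eN n ε) α) +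
        (H * ((n : ℝ) - 2 * (a + 1 : ℕ) + 2)) • intProdSucc (eN n ε) α)) p w
  rw [h1, lieD_apply hε hH p (hasFDerivAt_intProdSucc h0 (hα p)).differentiableAt,
    fderiv_intProdSucc_apply h0 (hα p), eNDeriv_self hε hH, h4, h5, h2, h3, etaUpNN_eq hn hε]
  push_cast
  ring

end Normal

/-! ### Smoothness and the exterior derivative -/

section Smooth

open Filter Topology

variable {n : ℕ} {ε H : ℝ} {V : Set (E n)} {a : ℕ}

theorem minSmoothness_two_le : minSmoothness ℝ 2 ≤ (∞ : WithTop ℕ∞) := by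
  rw [minSmoothness_of_isRCLikeNormedField]
  exact WithTop.coe_le_coe.2 (le_top : (2 : ℕ∞) ≤ ⊤)

theorem contDiffOn_extDeriv (hV : IsOpen V) {β : Form n a} (hβ : ContDiffOn ℝ ∞ β V) :
    ContDiffOn ℝ ∞ (extDeriv β) V :=
  (ContinuousAlternatingMap.alternatizeUncurryFinCLM ℝ (E n) ℝ).contDiff.comp_contDiffOn
    (hβ.fderiv_of_isOpen hV (by simp))

theorem contDiffOn_intProdSucc {v : E n → E n} (hv : ContDiffOn ℝ ∞ v V) {β : Form n (a + 1)}
    (hβ : ContDiffOn ℝ ∞ β V) : ContDiffOn ℝ ∞ (intProdSucc v β) V := by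
  have h1 := (ContinuousLinearMap.contDiff (n := ∞) (F := E n →L[ℝ] E n [⋀^Fin a]→L[ℝ] ℝ)
    curryLeftCLM).comp_contDiffOn hβ
  exact h1.clm_apply hv

theorem contDiffOn_dPred_intProd (hV : IsOpen V) {v : E n → E n} (hv : ContDiffOn ℝ ∞ v V)
    {β : Form n a} (hβ : ContDiffOn ℝ ∞ β V) : ContDiffOn ℝ ∞ (dPred (intProd v β)) V := by
  cases a with
  | zero => exact contDiffOn_const
  | succ a => exact contDiffOn_extDeriv hV (contDiffOn_intProdSucc hv hβ)

theorem contDiffOn_lieD (hV : IsOpen V) {v : E n → E n} (hv : ContDiffOn ℝ ∞ v V)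
    {β : Form n a} (hβ : ContDiffOn ℝ ∞ β V) : ContDiffOn ℝ ∞ (lieD v β) V :=
  (contDiffOn_intProdSucc hv (contDiffOn_extDeriv hV hβ)).add (contDiffOn_dPred_intProd hV hv hβ)

/-- Smoothness is read off from `δ = -tr ∇`; the definition of `codiffSucc`, by means of `hodgeInv`,
does not show it. -/
theorem contDiffOn_codiffSucc (hε : ε ≠ 0) (hV : IsOpen V) {α : Form n (a + 1)}
    (hα : ContDiffOn ℝ ∞ α V) : ContDiffOn ℝ ∞ (codiffSucc n ε α) V := by
  have h1 : ContDiffOn ℝ ∞ (fun y => -traceForm (eta n ε) (fderiv ℝ α y)) V := by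
    have h2 := hα.fderiv_of_isOpen (m := ∞) hV (by simp)
    simp only [traceForm]
    refine (ContDiffOn.sum fun i _ => ?_).neg
    have h3 := (ContinuousLinearMap.contDiff (n := ∞) (F := E n →L[ℝ] E n [⋀^Fin a]→L[ℝ] ℝ)
      curryLeftCLM).comp_contDiffOn (h2.clm_apply
        (contDiffOn_const (c := raised (eta n ε) (Module.finBasis ℝ (E n)) i)))
    exact h3.clm_apply contDiffOn_const
  exact h1.congr fun y hy =>
    codiffSucc_eq hε ((hα.contDiffAt (hV.mem_nhds hy)).differentiableAt (by simp))

theorem isOpen_eta_ne_zero : IsOpen {y : E n | eta n ε y y ≠ 0} := by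
  have : Continuous fun y : E n => eta n ε y y :=
    continuous_iff_continuousAt.2 fun y => (hasFDerivAt_eta_self y).continuousAt
  exact isOpen_ne_fun this continuous_const

theorem contDiffOn_eN : ContDiffOn ℝ ∞ (eN n ε) {y : E n | eta n ε y y ≠ 0} := by
  intro y hy
  have h1 : ContDiff ℝ ∞ fun y : E n => eta n ε y y :=
    (eta n ε).toContinuousBilinearMap.contDiff.clm_apply contDiff_id
  have h2 : ContDiffAt ℝ ∞ (fun y : E n => √|eta n ε y y|) y :=
    (h1.contDiffAt.abs hy).sqrt (abs_ne_zero.2 hy)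
  exact ((h2.inv (Real.sqrt_ne_zero'.2 (abs_pos.2 hy))).smul contDiffAt_id).contDiffWithinAt

/-- The exterior derivative commutes with the restriction to the (anti-)de Sitter space. -/
theorem dS_restr (hε : ε = 1 ∨ ε = -1) (hH : 0 < H) {β : Form n a}
    (hβ : ∀ p : Sig n ε H, DifferentiableAt ℝ β p) :
    dS (restr ε H β) = restr ε H (extDeriv β) := by
  funext p
  rw [dS, (pullS_restr_eventuallyEq hε hH p β).extDeriv_eq, extDeriv_pullback
    (by rw [param_zero]; exact hβ p) (contDiffAt_param p) minSmoothness_two_le, fderiv_param_zero,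
    param_zero, restr]

theorem restr_add (α β : Form n a) : restr ε H (α + β) = restr ε H α + restr ε H β := rfl

theorem restr_smul (c : ℝ) (α : Form n a) : restr ε H (c • α) = c • restr ε H α := rfl

theorem restr_neg (α : Form n a) : restr ε H (-α) = -restr ε H α := rfl

theorem restr_congr {α β : Form n a} (h : Set.EqOn α β (Sig n ε H)) :
    restr ε H α = restr ε H β := by
  funext p
  rw [restr, restr, h p.2]

theorem eqOn_extDeriv_add (hV : IsOpen V) {α β : Form n a} (hα : ContDiffOn ℝ ∞ α V)
    (hβ : ContDiffOn ℝ ∞ β V) :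
    Set.EqOn (extDeriv (α + β)) (extDeriv α + extDeriv β) V := fun _ hy =>
  extDeriv_add ((hα.contDiffAt (hV.mem_nhds hy)).differentiableAt (by simp))
    ((hβ.contDiffAt (hV.mem_nhds hy)).differentiableAt (by simp))

theorem eqOn_extDeriv_extDeriv (hV : IsOpen V) {α : Form n a} (hα : ContDiffOn ℝ ∞ α V) :
    Set.EqOn (extDeriv (extDeriv α)) 0 V := fun _ hy =>
  extDeriv_extDeriv_apply (hα.contDiffAt (hV.mem_nhds hy)) minSmoothness_two_le

theorem eqOn_lieD_add (hV : IsOpen V) {v : E n → E n} (hv : ContDiffOn ℝ ∞ v V)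
    {α β : Form n a} (hα : ContDiffOn ℝ ∞ α V) (hβ : ContDiffOn ℝ ∞ β V) :
    Set.EqOn (lieD v (α + β)) (lieD v α + lieD v β) V := by
  intro y hy
  have h1 : intProdSucc v (extDeriv (α + β)) y =
      intProdSucc v (extDeriv α) y + intProdSucc v (extDeriv β) y := by
    rw [intProdSucc, eqOn_extDeriv_add hV hα hβ hy]
    rfl
  have h2 : dPred (intProd v (α + β)) y = dPred (intProd v α) y + dPred (intProd v β) y := by
    cases a with
    | zero => simp [dPred]
    | succ a =>
      exact eqOn_extDeriv_add hV (contDiffOn_intProdSucc hv hα) (contDiffOn_intProdSucc hv hβ) hy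
  simp only [lieD, Pi.add_apply, h1, h2]
  abel

/-- The Lie derivative commutes with `d`, since `d² = 0`. -/
theorem eqOn_lieD_extDeriv (hV : IsOpen V) {v : E n → E n} (hv : ContDiffOn ℝ ∞ v V)
    {β : Form n a} (hβ : ContDiffOn ℝ ∞ β V) :
    Set.EqOn (lieD v (extDeriv β)) (extDeriv (lieD v β)) V := by
  intro y hy
  have hd := contDiffOn_extDeriv hV hβ
  have h1 : intProdSucc v (extDeriv (extDeriv β)) y = 0 := by
    rw [intProdSucc, eqOn_extDeriv_extDeriv hV hβ hy]
    rfl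
  have h2 : extDeriv (dPred (intProd v β)) y = 0 := by
    cases a with
    | zero =>
      change extDeriv (0 : Form n 0) y = 0
      rw [extDeriv, fderiv_zero]
      exact map_zero (ContinuousAlternatingMap.alternatizeUncurryFinCLM ℝ (E n) ℝ)
    | succ a => exact eqOn_extDeriv_extDeriv hV (contDiffOn_intProdSucc hv hβ) hy
  have h3 : extDeriv (lieD v β) y = extDeriv (intProdSucc v (extDeriv β)) y +
      extDeriv (dPred (intProd v β)) y :=
    eqOn_extDeriv_add hV (contDiffOn_intProdSucc hv hd) (contDiffOn_dPred_intProd hV hv hβ) hy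
  rw [h3, h2, add_zero]
  change intProdSucc v (extDeriv (extDeriv β)) y + extDeriv (intProdSucc v (extDeriv β)) y = _
  rw [h1, zero_add]

end Smooth

/-! ### The Laplace-de Rham operator -/

section Box

variable {n : ℕ} {ε H : ℝ} {V : Set (E n)} {a : ℕ}

theorem extDeriv_const_smul (c : ℝ) (β : Form n a) : extDeriv (c • β) = c • extDeriv β := by
  funext y
  exact extDeriv_smul c β

theorem differentiableAt_of_contDiffOn (hV : IsOpen V) (hS : Sig n ε H ⊆ V) {β : Form n a}
    (hβ : ContDiffOn ℝ ∞ β V) (p : Sig n ε H) : DifferentiableAt ℝ β p :=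
  (hβ.contDiffAt (hV.mem_nhds (hS p.2))).differentiableAt (by simp)

theorem intProdSucc_extDeriv_zero (v : E n → E n) :
    intProdSucc v (extDeriv (0 : Form n a)) = 0 := by
  funext y
  rw [intProdSucc, extDeriv, fderiv_zero]
  have : ContinuousAlternatingMap.alternatizeUncurryFin
      ((0 : E n → E n →L[ℝ] E n [⋀^Fin a]→L[ℝ] ℝ) y) = 0 :=
    map_zero (ContinuousAlternatingMap.alternatizeUncurryFinCLM ℝ (E n) ℝ)
  rw [this]
  rfl

theorem lieD_zero (v : E n → E n) : lieD v (0 : Form n 0) = 0 := by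
  rw [lieD, intProdSucc_extDeriv_zero]
  exact add_zero _

/-- The exterior derivative of the formula for the codifferential. It includes degree `0`, where
all terms vanish. -/
theorem dPredS_codiffS_restr (hn : 1 ≤ n) (hε : ε = 1 ∨ ε = -1) (hH : 0 < H) (hV : IsOpen V)
    (hS : Sig n ε H ⊆ V) (hv : ContDiffOn ℝ ∞ (eN n ε) V) {α : Form n a}
    (hα : ContDiffOn ℝ ∞ α V) :
    dPredS (codiffS (restr ε H α)) = restr ε H (dPred (codiff n ε α) +
      etaUpNN n ε • (lieD (eN n ε) (dPred (intProd (eN n ε) α)) +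
        (H * ((n : ℝ) - 2 * a + 2)) • dPred (intProd (eN n ε) α))) := by
  cases a with
  | zero =>
    simp only [dPredS, dPred, lieD_zero, smul_zero, add_zero]
    rfl
  | succ a =>
    set c : ℝ := H * ((n : ℝ) - 2 * (a + 1 : ℕ) + 2)
    set β : Form n a := intProdSucc (eN n ε) α with hβ
    have h1 : ContDiffOn ℝ ∞ β V := contDiffOn_intProdSucc hv hα
    have h2 : ContDiffOn ℝ ∞ (c • β) V := h1.const_smul c
    have h3 : ContDiffOn ℝ ∞ (lieD (eN n ε) β) V := contDiffOn_lieD hV hv h1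
    have h4 : ContDiffOn ℝ ∞ (etaUpNN n ε • (lieD (eN n ε) β + c • β)) V :=
      (h3.add h2).const_smul (etaUpNN n ε)
    have h5 : ContDiffOn ℝ ∞ (codiffSucc n ε α) V := contDiffOn_codiffSucc (sign_ne_zero hε) hV hα
    have h6 : codiffS (restr ε H α) = restr ε H (codiffSucc n ε α +
        etaUpNN n ε • (lieD (eN n ε) β + c • β)) := by
      rw [restr_add,
        restr_codiffSucc_eq_sub_lieD hn hε hH (differentiableAt_of_contDiffOn hV hS hα)]
      funext p
      exact (sub_add_cancel (codiffSuccS (restr ε H α) p) _).symm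
    change dS (codiffS (restr ε H α)) = restr ε H (extDeriv (codiffSucc n ε α) +
      etaUpNN n ε • (lieD (eN n ε) (extDeriv β) + c • extDeriv β))
    have h7 : ContDiffOn ℝ ∞ (codiffSucc n ε α + etaUpNN n ε • (lieD (eN n ε) β + c • β)) V :=
      h5.add h4
    rw [h6, dS_restr hε hH (differentiableAt_of_contDiffOn hV hS h7)]
    refine restr_congr fun y hy => ?_
    rw [eqOn_extDeriv_add hV h5 h4 (hS hy), Pi.add_apply, Pi.add_apply, extDeriv_const_smul,
      Pi.smul_apply, Pi.smul_apply, eqOn_extDeriv_add hV h3 h2 (hS hy), extDeriv_const_smul,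
      Pi.add_apply, Pi.add_apply, eqOn_lieD_extDeriv hV hv h1 (hS hy)]

end Box

end AdS

end

theorem theorem1 (n : ℕ) (hn : 1 ≤ n) (ε : ℝ) (hε : ε = 1 ∨ ε = -1) (H : ℝ) (hH : 0 < H)
    (U : Set (E n)) (hU : IsOpen U) (hSU : Sig n ε H ⊆ U)
    (a : ℕ) (α : Form n a) (hα : ContDiffOn ℝ ∞ α U) :
    restr ε H (codiff n ε α) =
        codiffS (restr ε H α) -
          etaUpNN n ε • restr ε H
            (lieD (eN n ε) (intProd (eN n ε) α) +
              (H * ((n : ℝ) - 2 * a + 2)) • intProd (eN n ε) α) ∧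
      restr ε H (box n ε α) =
        boxS (restr ε H α) +
          etaUpNN n ε • restr ε H
            (lieD (eN n ε) (lieD (eN n ε) α) +
              (H * ((n : ℝ) - 2 * a)) • lieD (eN n ε) α +
              (2 * H) • dPred (intProd (eN n ε) α)) := by
  -- The field `e_n` is smooth only where `y² ≠ 0`, so `U` is replaced by a smaller neighbourhood.
  set V : Set (E n) := U ∩ {y | eta n ε y y ≠ 0}
  have hV : IsOpen V := hU.inter isOpen_eta_ne_zero
  have hS : Sig n ε H ⊆ V := fun y hy =>
    ⟨hSU hy, eta_self_ne_zero (sign_ne_zero hε) hH ⟨y, hy⟩⟩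
  have hv : ContDiffOn ℝ ∞ (eN n ε) V := contDiffOn_eN.mono Set.inter_subset_right
  replace hα : ContDiffOn ℝ ∞ α V := hα.mono Set.inter_subset_left
  have hdα : ContDiffOn ℝ ∞ (extDeriv α) V := contDiffOn_extDeriv hV hα
  have hd := fun p => differentiableAt_of_contDiffOn hV hS hα p
  constructor
  · cases a with
    | zero =>
      simp only [codiff, codiffS, intProd, lieD_zero, smul_zero, add_zero]
      funext p
      ext w
      change (0 : ℝ) = 0 - etaUpNN n ε * 0
      ring
    | succ a => exact restr_codiffSucc_eq_sub_lieD hn hε hH hd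
  · have h1 := restr_codiffSucc_eq_sub_lieD hn hε hH (differentiableAt_of_contDiffOn hV hS hdα)
    have h2 := dPredS_codiffS_restr hn hε hH hV hS hv hα
    have h3 : restr ε H (lieD (eN n ε) (lieD (eN n ε) α)) =
        restr ε H (lieD (eN n ε) (intProdSucc (eN n ε) (extDeriv α)) +
          lieD (eN n ε) (dPred (intProd (eN n ε) α))) :=
      restr_congr fun y hy => eqOn_lieD_add hV hv (contDiffOn_intProdSucc hv hdα)
        (contDiffOn_dPred_intProd hV hv hα) (hS hy)
    rw [box, boxS, dS_restr hε hH hd, h2]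
    simp only [restr_neg, restr_add, restr_smul, h1, h3]
    -- Both sides are now combinations of the same restricted forms. The coefficients of
    -- `d i_n α` agree since `H (n - 2a + 2) = H (n - 2a) + 2H`, and those of `i_n dα` since
    -- `H (n - 2(a + 1) + 2) = H (n - 2a)`.
    rw [show lieD (eN n ε) α = intProdSucc (eN n ε) (extDeriv α) +
      dPred (intProd (eN n ε) α) from rfl, restr_add]
    push_cast
    module
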